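/- Let $q$ be an odd prime power, let $\alpha\colon x\mapsto x^q$ be the automorphism of order two of $\mathbb F_{q^2}$, and let $M(q^2)$ be the subgroup of $\mathrm{PGL}(2,\mathbb F_{q^2})\rtimes\langle\alpha\rangle$ generated by $\mathrm{PSL}(2,\mathbb F_{q^2})$ and all $\alpha\tau$ with $\tau\in \mathrm{PGL}(2,\mathbb F_{q^2})\setminus \mathrm{PSL}(2,\mathbb F_{q^2})$ (for $q=3$ this group is known as $M_{10}$). **Definitions.** For a surjection $f\colon G\to H$ of finite groups with kernel $P$ such that $|P_{ab}|$ is odd, let $1\to H_2(P,\mathbb Z/2)\to C\xrightarrow{p} P\to 1$ be the central extension that corresponds, under the universal coefficient isomorphism $H^2(P,H_2(P,\mathbb Z/2))\cong \mathrm{Hom}(H_2(P,\mathbb Z),H_2(P,\mathbb Z/2))$, to the map induced by reduction $\mathbb Z\to\mathbb Z/2$. With the action of $G$ on $C$ that is compatible with the conjugation actions of $G$ on $P$ and on $H_2(P,\mathbb Z/2)$, the composite $C\to P\hookrightarrow G$ is a crossed module, and the characteristic class $\tilde o_2\in H^3(H,H_2(P,\mathbb Z/2))$ of the resulting exact sequence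 $1\to H_2(P,\mathbb Z/2)\to C\to G\to H\to 1$ is called the $\mathbb Z/2$-obstruction of $f$. A finite group $G$ has property $(\ast)_a$ if there is a surjection $f\colon G\to\mathbb Z/2$ with kernel $P$ such that $|P_{ab}|$ is odd and the $\mathbb Z/2$-obstruction $\tilde o_2\in H^3(\mathbb Z/2,H_2(P,\mathbb Z/2))$ of $f$ is (defined and) non-zero. **Proposition.** For every $\tau\in \mathrm{PGL}(2,\mathbb F_{q^2})\setminus \mathrm{PSL}(2,\mathbb F_{q^2})$ one has $M(q^2)=\mathrm{PSL}(2,\mathbb F_{q^2})\cup\alpha\tau\,\mathrm{PSL}(2,\mathbb F_{q^2})$, and $M(q^2)$ has index $2$ in $\mathrm{PGL}(2,\mathbb F_{q^2})\rtimes\langle\alpha\rangle$. The group $M(q^2)$ has property $(\ast)_a$. More precisely, let $f\colon M(q^2)\to\mathbb Z/2$ be the surjection with kernel $\mathrm{PSL}(2,\mathbb F_{q^2})$. Then there is an isomorphism $H_2(\mathrm{PSL}(2,\mathbb F_{q^2}),\mathbb Z/2)\cong\mathbb Z/2$ of $\mathbb Z/2$-modules such that, with this identification of the kernel, the crossed module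 $$1\to\mathbb Z/2=\{\pm1\}\to \mathrm{SL}(2,\mathbb F_{q^2})\to M(q^2)\xrightarrow{f}\mathbb Z/2\to1,$$ where $\mathrm{PGL}(2,\mathbb F_{q^2})$ acts on $\mathrm{SL}(2,\mathbb F_{q^2})$ by conjugation and $\alpha$ acts entrywise, is a crossed module that defines the $\mathbb Z/2$-obstruction of $f$; and the $\mathbb Z/2$-obstruction, which is its class in $H^3(\mathbb Z/2,\mathbb Z/2)$, equals $u\cup u\cup u$, where $u$ is the unique non-zero element of $H^1(\mathbb Z/2,\mathbb Z/2)$. -/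

import Mathlib

open CategoryTheory
open scoped MatrixGroups

noncomputable section

/-! ### The second homology group and its functoriality -/

/-- `H₂(P, A)`, the second homology group of `P` with coefficients in the trivial module `A`. -/
abbrev HTwo (P A : Type) [Group P] [AddCommGroup A] : ModuleCat ℤ :=
  groupHomology (Rep.trivial ℤ P A) 2

/-- The map `H₂(P, A) → H₂(Q, B)` induced by `φ : P → Q` and `s : A → B`. -/
def HTwo.map {P Q A B : Type} [Group P] [Group Q] [AddCommGroup A] [AddCommGroup B]
    (φ : P →* Q) (s : A →+ B) : HTwo P A →ₗ[ℤ] HTwo Q B :=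
  (groupHomology.map (A := Rep.trivial ℤ P A) (B := Rep.trivial ℤ Q B) φ
    (Rep.ofHom ⟨s.toIntLinearMap, fun _ => rfl⟩) 2).hom

theorem HTwo.map_id (P A : Type) [Group P] [AddCommGroup A] :
    HTwo.map (MonoidHom.id P) (AddMonoidHom.id A) = LinearMap.id := by
  have h := groupHomology.map_id (A := Rep.trivial ℤ P A) (n := 2)
  exact congrArg ModuleCat.Hom.hom h

theorem HTwo.map_comp {P Q R A B D : Type} [Group P] [Group Q] [Group R]
    [AddCommGroup A] [AddCommGroup B] [AddCommGroup D]
    (φ : P →* Q) (ψ : Q →* R) (s : A →+ B) (t : B →+ D) :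
    HTwo.map (ψ.comp φ) (t.comp s) = HTwo.map ψ t ∘ₗ HTwo.map φ s := by
  have h := groupHomology.map_comp (A := Rep.trivial ℤ P A) (B := Rep.trivial ℤ Q B)
    (C := Rep.trivial ℤ R D) φ ψ
    (Rep.ofHom ⟨s.toIntLinearMap, fun _ => rfl⟩) (Rep.ofHom ⟨t.toIntLinearMap, fun _ => rfl⟩) 2
  exact congrArg ModuleCat.Hom.hom h

/-- Inner automorphisms act trivially on `H₂(P, A)`. -/
theorem HTwo.map_conj (P A : Type) [Group P] [AddCommGroup A] (s : P) :
    HTwo.map (MulAut.conj s).toMonoidHom (AddMonoidHom.id A) = LinearMap.id := by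
  let T : Rep ℤ P := Rep.trivial ℤ P A
  let φ : T ⟶ Rep.res (MulAut.conj s).toMonoidHom T :=
    Rep.ofHom ⟨(AddMonoidHom.id A).toIntLinearMap, fun _ => rfl⟩
  let k : (P →₀ A) →ₗ[ℤ] (P × P →₀ A) := Finsupp.lsum ℤ fun x =>
    Finsupp.lsingle (s, x) - Finsupp.lsingle (s * x * s⁻¹, s)
  let h : (P × P →₀ A) →ₗ[ℤ] (P × P × P →₀ A) := Finsupp.lsum ℤ fun x =>
    Finsupp.lsingle (s, x.1, x.2) - Finsupp.lsingle (s * x.1 * s⁻¹, s, x.2) +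
      Finsupp.lsingle (s * x.1 * s⁻¹, s * x.2 * s⁻¹, s)
  have key : ∀ y : P × P →₀ A, (groupHomology.d₃₂ T).hom (h y) =
      y - (groupHomology.chainsMap₂ (MulAut.conj s).toMonoidHom φ).hom y -
        k ((groupHomology.d₂₁ T).hom y) := by
    intro y
    induction y using Finsupp.induction_linear with
    | zero => simp
    | add a b ha hb => simp only [map_add, ha, hb]; abel
    | single x a =>
      have h1 : h (Finsupp.single x a) = Finsupp.single (s, x.1, x.2) a -
          Finsupp.single (s * x.1 * s⁻¹, s, x.2) a +
            Finsupp.single (s * x.1 * s⁻¹, s * x.2 * s⁻¹, s) a := by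
        simp [h]
      have h2 : ∀ g : P, k (Finsupp.single g a) =
          Finsupp.single (s, g) a - Finsupp.single (s * g * s⁻¹, s) a := by
        intro g; simp [k]
      have h3 : (groupHomology.chainsMap₂ (MulAut.conj s).toMonoidHom φ).hom (Finsupp.single x a) =
          Finsupp.single (s * x.1 * s⁻¹, s * x.2 * s⁻¹) a :=
        (congrArg (Finsupp.mapRange.linearMap φ.hom.toLinearMap)
          (Finsupp.mapDomain_single ..)).trans (Finsupp.mapRange_single (hf := map_zero _) ..)
      have h4 : ∀ u v w : P, (groupHomology.d₃₂ T).hom (Finsupp.single (u, v, w) a) =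
          Finsupp.single (v, w) a - Finsupp.single (u * v, w) a +
            Finsupp.single (u, v * w) a - Finsupp.single (u, v) a :=
        fun u v w => groupHomology.d₃₂_single (A := T) (u, v, w) a
      have h5 : (groupHomology.d₂₁ T).hom (Finsupp.single x a) =
          Finsupp.single x.2 a - Finsupp.single (x.1 * x.2) a + Finsupp.single x.1 a :=
        groupHomology.d₂₁_single (A := T) x a
      have h6 : (groupHomology.d₃₂ T).hom (h (Finsupp.single x a)) =
          (groupHomology.d₃₂ T).hom (Finsupp.single (s, x.1, x.2) a) -
          (groupHomology.d₃₂ T).hom (Finsupp.single (s * x.1 * s⁻¹, s, x.2) a) +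
          (groupHomology.d₃₂ T).hom (Finsupp.single (s * x.1 * s⁻¹, s * x.2 * s⁻¹, s) a) := by
        rw [h1]
        exact (map_add (groupHomology.d₃₂ T).hom _ _).trans
          (congrArg (· + _) (map_sub (groupHomology.d₃₂ T).hom _ _))
      have h7 : k ((groupHomology.d₂₁ T).hom (Finsupp.single x a)) =
          k (Finsupp.single x.2 a) - k (Finsupp.single (x.1 * x.2) a) +
            k (Finsupp.single x.1 a) := by
        rw [h5]
        exact (map_add k _ _).trans (congrArg (· + _) (map_sub k _ _))
      rw [h6, h4, h4, h4, h3, h7, h2, h2, h2]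
      simp only [mul_assoc, inv_mul_cancel_left, inv_mul_cancel, mul_one]
      abel
  refine LinearMap.ext fun z => ?_
  induction z using groupHomology.H2_induction_on with
  | h x =>
    have e := congrArg (fun t => t.hom x)
      (groupHomology.H2π_comp_map (A := T) (B := T) (MulAut.conj s).toMonoidHom φ)
    refine e.trans ?_
    symm
    refine (groupHomology.H2π_eq_iff (A := T) _ _).2 ?_
    refine ⟨h x.1, ?_⟩
    have hx : (groupHomology.d₂₁ T).hom x.1 = 0 := x.2
    rw [key, hx, map_zero, sub_zero]
    rfl

/-- For a normal subgroup `P` of `G`, the action of `G` on `H₂(P, A)` by conjugation on `P`. -/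
def conjRep {G : Type} [Group G] (P : Subgroup G) [P.Normal] (A : Type) [AddCommGroup A] :
    Representation ℤ G (HTwo P A) where
  toFun g := HTwo.map (MulAut.conjNormal g : MulAut P).toMonoidHom (AddMonoidHom.id A)
  map_one' := by
    rw [map_one]; exact HTwo.map_id P A
  map_mul' g h := by
    rw [map_mul]
    exact HTwo.map_comp (MulAut.conjNormal h : MulAut P).toMonoidHom
      (MulAut.conjNormal g : MulAut P).toMonoidHom (AddMonoidHom.id A) (AddMonoidHom.id A)

theorem ker_le_ker_conjRep {G H : Type} [Group G] [Group H] (f : G →* H)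
    (A : Type) [AddCommGroup A] : f.ker ≤ (conjRep f.ker A).toHomUnits.ker := fun g hg => by
  rw [MonoidHom.mem_ker]
  refine Units.ext (Eq.trans ?_ (HTwo.map_conj f.ker A ⟨g, hg⟩))
  change HTwo.map _ _ = HTwo.map _ _
  congr 1

/-- For a surjection `f : G → H` with kernel `P`, the action of `H` on `H₂(P, A)`: an element `f g`
of `H` acts through conjugation by `g`. -/
def kerRep {G H : Type} [Group G] [Group H] (f : G →* H) (hf : Function.Surjective f)
    (A : Type) [AddCommGroup A] : Representation ℤ H (HTwo f.ker A) :=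
  (Units.coeHom _).comp
    (f.liftOfSurjective hf ⟨(conjRep f.ker A).toHomUnits, ker_le_ker_conjRep f A⟩)

theorem kerRep_apply {G H : Type} [Group G] [Group H] (f : G →* H) (hf : Function.Surjective f)
    (A : Type) [AddCommGroup A] (g : G) : kerRep f hf A (f g) = conjRep f.ker A g :=
  congrArg Units.val (MonoidHom.liftOfRightInverse_comp_apply f _ (Function.rightInverse_surjInv hf)
    ⟨(conjRep f.ker A).toHomUnits, ker_le_ker_conjRep f A⟩ g)

/-! ### Central extensions and crossed modules -/

/-- `1 → N → C → P → 1` is a central extension. -/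
structure IsCentralExtension {N C P : Type} [AddCommGroup N] [Group C] [Group P]
    (ι : Multiplicative N →* C) (p : C →* P) : Prop where
  injective : Function.Injective ι
  surjective : Function.Surjective p
  exact : ι.range = p.ker
  central : ι.range ≤ Subgroup.center C

/-- `1 → H₂(P, A) → C → P → 1` is the `a`-central extension of `P`. For a set-theoretic section
`σ` of `p` with factor set `u`, i.e. `σ(x) σ(y) = u(x, y) σ(xy)`, the homomorphism
`H₂(P, ℤ) → H₂(P, A)` that the universal coefficient theorem attaches to the extension sends the
class of a cycle `∑ n_{x,y} (x, y)` to `∑ n_{x,y} u(x, y)`. It has to be the map induced by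
the homomorphism `ℤ → A` with `1 ↦ a`. -/
structure IsElementCentralExtension {P A C : Type} [Group P] [AddCommGroup A] [Group C] (a : A)
    (ι : Multiplicative (HTwo P A) →* C) (p : C →* P) : Prop
    extends IsCentralExtension ι p where
  classified : ∃ (σ : P → C) (u : P × P → HTwo P A),
    (∀ x, p (σ x) = x) ∧
    (∀ x y, σ x * σ y = ι (Multiplicative.ofAdd (u (x, y))) * σ (x * y)) ∧
    ∀ z : groupHomology.cycles₂ (Rep.trivial ℤ P ℤ),
      HTwo.map (MonoidHom.id P) (zmultiplesHom A a)
          (groupHomology.H2π (Rep.trivial ℤ P ℤ) z) =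
        Finsupp.sum (z : P × P →₀ ℤ) fun xy n => n • u xy

/-- The homomorphism `d : C → G` and the action of `G` on `C` form a crossed module. -/
structure IsCrossedModule {C G : Type} [Group C] [Group G] (d : C →* G) (act : G →* MulAut C) :
    Prop where
  map_act : ∀ g c, d (act g c) = g * d c * g⁻¹
  peiffer : ∀ c c', act (d c) c' = c * c' * c⁻¹

/-- `1 → N → C → G → H → 1` is a crossed module extension (with maps `ι`, `d`, `f`) inducing the
given `H`-module structure on `N`. -/
structure IsCrossedExtension {C G H : Type} [Group C] [Group G] [Group H] (N : Rep.{0} ℤ H)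
    (ι : Multiplicative N →* C) (d : C →* G) (act : G →* MulAut C) (f : G →* H) : Prop
    extends IsCrossedModule d act where
  injective : Function.Injective ι
  exact_left : ι.range = d.ker
  exact_right : d.range = f.ker
  surjective : Function.Surjective f
  act_kernel : ∀ (g : G) (n : N),
    act g (ι (Multiplicative.ofAdd n)) = ι (Multiplicative.ofAdd (N.ρ (f g) n))

/-- `o ∈ H³(H, N)` is a characteristic class of the crossed module extension
`1 → N → C → G → H → 1`: for a set-theoretic section `s` of `f`, and a lift `F` to `C` of the
factor set of `s`, so `s(x) s(y) = d(F(x, y)) s(xy)`, it is the class of the cocycle `c` with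
`ˢ⁽ˣ⁾F(y, z) · F(x, yz) = ι(c(x, y, z)) · F(x, y) · F(xy, z)`. -/
def IsClassOf {C G H : Type} [Group C] [Group G] [Group H] (N : Rep.{0} ℤ H)
    (ι : Multiplicative N →* C) (d : C →* G) (act : G →* MulAut C) (f : G →* H)
    (o : groupCohomology N 3) : Prop :=
  IsCrossedExtension N ι d act f ∧
  ∃ (s : H → G) (F : H → H → C) (c : groupCohomology.cocycles N 3),
    (∀ x, f (s x) = x) ∧
    (∀ x y, s x * s y = d (F x y) * s (x * y)) ∧
    (∀ x y z, act (s x) (F y z) * F x (y * z) =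
      ι (Multiplicative.ofAdd (groupCohomology.iCocycles N 3 c ![x, y, z])) *
        F x y * F (x * y) z) ∧
    groupCohomology.π N 3 c = o

/-! ### The obstruction and the property `(∗)ₐ` -/

/-- The `(A, a)`-obstruction crossed module of a homomorphism `f : G → H` with kernel `P`: an
`a`-central extension `1 → H₂(P, A) → C → P → 1` with an action of `G` on `C`, compatible with
the actions of `G` on `P` and on `H₂(P, A)`, such that the composite `C → P → G` is a crossed
module. -/
structure IsObstructionCrossedModule {C G H A : Type} [Group C] [Group G] [Group H]
    [AddCommGroup A] (f : G →* H) (a : A) (ι : Multiplicative (HTwo f.ker A) →* C)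
    (p : C →* f.ker) (act : G →* MulAut C) : Prop where
  extension : IsElementCentralExtension a ι p
  crossed : IsCrossedModule (f.ker.subtype.comp p) act
  act_proj : ∀ g c, p (act g c) = MulAut.conjNormal g (p c)
  act_kernel : ∀ (g : G) (n : HTwo f.ker A),
    act g (ι (Multiplicative.ofAdd n)) = ι (Multiplicative.ofAdd (conjRep f.ker A g n))

/-- The classes in `H³(H, H₂(P, A))` of all `(A, a)`-obstruction crossed modules of the
surjection `f : G → H` with kernel `P`. -/
def obstructionClasses {G H A : Type} [Group G] [Group H] [AddCommGroup A] (f : G →* H)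
    (hf : Function.Surjective f) (a : A) :
    Set (groupCohomology (Rep.of (kerRep f hf A)) 3) :=
  {o | ∃ (C : Type) (_ : Group C) (ι : Multiplicative (HTwo f.ker A) →* C) (p : C →* f.ker)
    (act : G →* MulAut C), IsObstructionCrossedModule f a ι p act ∧
      IsClassOf (Rep.of (kerRep f hf A)) ι (f.ker.subtype.comp p) act f o}

/-- `o` is the `(A, a)`-obstruction of `f`: an `(A, a)`-obstruction crossed module of `f` exists,
and `o` is the class of all of them. -/
def IsObstruction {G H A : Type} [Group G] [Group H] [AddCommGroup A] (f : G →* H)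
    (hf : Function.Surjective f) (a : A) (o : groupCohomology (Rep.of (kerRep f hf A)) 3) : Prop :=
  obstructionClasses f hf a = {o}

/-- The cyclic group of order two, written multiplicatively. -/
abbrev CTwo : Type := Multiplicative (ZMod 2)

/-- The property `(∗)ₐ` of a finite group `G`: there is a surjection `f : G → ℤ/2` with kernel `P`
such that the order of the abelianization of `P` is odd and the `ℤ/2`-obstruction
(for the element `1 ∈ ℤ/2`) in `H³(ℤ/2, H₂(P, ℤ/2))` is non-zero. -/
def PropertyStarA (G : Type) [Group G] : Prop :=
  Finite G ∧ ∃ (f : G →* CTwo) (hf : Function.Surjective f),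
    Odd (Nat.card (Abelianization f.ker)) ∧
    ∃ o, IsObstruction f hf (1 : ZMod 2) o ∧ o ≠ 0

/-! ### Cup products with trivial coefficients -/

/-- `H^n(G, R)` with trivial action on `R`. -/
abbrev HTriv (G R : Type) [Group G] [CommRing R] (n : ℕ) : ModuleCat ℤ :=
  groupCohomology (Rep.trivial ℤ G R) n

/-- `w = u ∪ v` in `H^*(G, R)`, for a ring `R` with trivial action of `G`: there are cocycles
`φ`, `ψ` representing `u`, `v` such that
`(g₁, …, g_{m+n}) ↦ φ(g₁, …, g_m) ψ(g_{m+1}, …, g_{m+n})` is a cocycle representing `w`. -/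
def IsCup {G R : Type} [Group G] [CommRing R] {m n : ℕ}
    (u : HTriv G R m) (v : HTriv G R n) (w : HTriv G R (m + n)) : Prop :=
  ∃ (φ : groupCohomology.cocycles (Rep.trivial ℤ G R) m)
    (ψ : groupCohomology.cocycles (Rep.trivial ℤ G R) n)
    (χ : groupCohomology.cocycles (Rep.trivial ℤ G R) (m + n)),
    groupCohomology.π _ m φ = u ∧ groupCohomology.π _ n ψ = v ∧
    groupCohomology.π _ (m + n) χ = w ∧
    ∀ g : Fin (m + n) → G,
      (groupCohomology.iCocycles (Rep.trivial ℤ G R) (m + n) χ g : R) =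
        (groupCohomology.iCocycles (Rep.trivial ℤ G R) m φ (fun i => g (Fin.castAdd n i)) : R) *
          (groupCohomology.iCocycles (Rep.trivial ℤ G R) n ψ (fun i => g (Fin.natAdd m i)) : R)

/-- `w = u ∪ u ∪ u`. -/
def IsCube {G R : Type} [Group G] [CommRing R] (u : HTriv G R 1) (w : HTriv G R 3) : Prop :=
  ∃ v : HTriv G R 2, IsCup u u v ∧ IsCup v u w

/-! ### The groups `PGL(2, F) ⋊ ⟨α⟩` and `M` -/

section Groups

variable {F : Type} [Field F]

/-- The action of automorphisms of `F` on `GL(2, F)`, entry by entry. -/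
def galGL (F : Type) [Field F] : RingAut F →* MulAut (GL (Fin 2) F) where
  toFun σ := Units.mapEquiv (RingEquiv.mapMatrix σ : Matrix (Fin 2) (Fin 2) F ≃+* _).toMulEquiv
  map_one' := by ext; rfl
  map_mul' _ _ := by ext; rfl

/-- The action of automorphisms of `F` on `SL(2, F)`, entry by entry. -/
def galSL (F : Type) [Field F] : RingAut F →* MulAut SL(2, F) where
  toFun σ := MonoidHom.toMulEquiv (Matrix.SpecialLinearGroup.map σ.toRingHom)
    (Matrix.SpecialLinearGroup.map σ.symm.toRingHom) (by ext; simp) (by ext; simp)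
  map_one' := by ext x i j; rfl
  map_mul' _ _ := by ext; rfl

/-- The action of automorphisms of `F` on `PGL(2, F)`, entry by entry. -/
def galPGL (F : Type) [Field F] : RingAut F →* MulAut PGL(2, F) where
  toFun σ := QuotientGroup.congr (Subgroup.center (GL (Fin 2) F)) (Subgroup.center (GL (Fin 2) F))
    (galGL F σ) (Subgroup.characteristic_iff_map_eq.1 inferInstance _)
  map_one' := by
    ext x; induction x using Matrix.ProjGenLinGroup.induction_on with | mk g => rfl
  map_mul' _ _ := by
    ext x; induction x using Matrix.ProjGenLinGroup.induction_on with | mk g => rfl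

/-- The action of `GL(2, F)` on `SL(2, F)` by conjugation. -/
def conjGL (F : Type) [Field F] : GL (Fin 2) F →* MulAut SL(2, F) where
  toFun g :=
    { toFun := fun x => ⟨g.1 * x.1 * g⁻¹.1, by
        rw [Matrix.det_mul, Matrix.det_mul, x.2, mul_one, ← Matrix.det_mul, Units.mul_inv,
          Matrix.det_one]⟩
      invFun := fun x => ⟨g⁻¹.1 * x.1 * g.1, by
        rw [Matrix.det_mul, Matrix.det_mul, x.2, mul_one, ← Matrix.det_mul, Units.inv_mul,
          Matrix.det_one]⟩
      left_inv := fun x => Subtype.ext (by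
        simp only [mul_assoc, Units.inv_mul, mul_one, Units.inv_mul_cancel_left])
      right_inv := fun x => Subtype.ext (by
        simp only [mul_assoc, Units.mul_inv, mul_one, Units.mul_inv_cancel_left])
      map_mul' := fun x y => Subtype.ext (by
        change g.1 * (x.1 * y.1) * g⁻¹.1 = (g.1 * x.1 * g⁻¹.1) * (g.1 * y.1 * g⁻¹.1)
        simp only [mul_assoc, Units.inv_mul_cancel_left]) }
  map_one' := MulEquiv.ext fun x => Subtype.ext (by
    change (1 : GL (Fin 2) F).1 * x.1 * (1 : GL (Fin 2) F)⁻¹.1 = x.1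
    simp)
  map_mul' g h := MulEquiv.ext fun x => Subtype.ext (by
    change (g * h).1 * x.1 * (g * h)⁻¹.1 = g.1 * (h.1 * x.1 * h⁻¹.1) * g⁻¹.1
    simp only [mul_inv_rev, Units.val_mul, mul_assoc])

/-- The action of `PGL(2, F)` on `SL(2, F)` by conjugation. -/
def conjPGL (F : Type) [Field F] : PGL(2, F) →* MulAut SL(2, F) :=
  Matrix.ProjGenLinGroup.lift (conjGL F) (by
    refine MonoidHom.ext fun u => MulEquiv.ext fun x => Subtype.ext ?_
    have h : (Matrix.GeneralLinearGroup.scalar (Fin 2) u) * Matrix.SpecialLinearGroup.toGL x =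
        Matrix.SpecialLinearGroup.toGL x * Matrix.GeneralLinearGroup.scalar (Fin 2) u :=
      (Matrix.GeneralLinearGroup.scalar_commute u _)
    have h' := congrArg Units.val (mul_inv_eq_of_eq_mul h)
    exact h')

/-- The semidirect product `PGL(2, F) ⋊ ⟨α⟩`, where `α` is an automorphism of `F`. -/
abbrev PGLSemi (α : RingAut F) : Type :=
  PGL(2, F) ⋊[(galPGL F).comp (Subgroup.zpowers α).subtype] Subgroup.zpowers α

/-- The element `α` of `PGL(2, F) ⋊ ⟨α⟩`. -/
def galElt (α : RingAut F) : PGLSemi α :=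
  SemidirectProduct.inr ⟨α, Subgroup.mem_zpowers α⟩

/-- The action of `PGL(2, F) ⋊ ⟨α⟩` on `SL(2, F)`. -/
def semiAct (α : RingAut F) : PGLSemi α →* MulAut SL(2, F) :=
  SemidirectProduct.lift (conjPGL F) ((galSL F).comp (Subgroup.zpowers α).subtype) (by
    intro σ
    refine MonoidHom.ext fun g => ?_
    induction g using Matrix.ProjGenLinGroup.induction_on with | mk g =>
    refine MulEquiv.ext fun x => Subtype.ext ?_
    let m : Matrix (Fin 2) (Fin 2) F ≃+* Matrix (Fin 2) (Fin 2) F := RingEquiv.mapMatrix σ.1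
    change m g.1 * x.1 * m g⁻¹.1 = m (g.1 * m.symm x.1 * g⁻¹.1)
    simp)

/-- The copy of `PSL(2, F)` in `PGL(2, F) ⋊ ⟨α⟩`. -/
def pslSub (α : RingAut F) : Subgroup (PGLSemi α) :=
  (SemidirectProduct.inl.comp Matrix.ProjectiveSpecialLinearGroup.toPGL).range

/-- The subgroup `M` of `PGL(2, F) ⋊ ⟨α⟩` generated by `PSL(2, F)` and all `ατ` with
`τ ∈ PGL(2, F) ∖ PSL(2, F)`. -/
def MGroup (α : RingAut F) : Subgroup (PGLSemi α) :=
  Subgroup.closure (pslSub α ∪ {x | ∃ τ : PGL(2, F),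
    τ ∉ (Matrix.ProjectiveSpecialLinearGroup.toPGL (n := Fin 2) (R := F)).range ∧
      x = galElt α * SemidirectProduct.inl τ})

/-- The homomorphism `ℤ/2 → SL(2, F)` with image `{1, -1}`. -/
def signSL (F : Type) [Field F] : CTwo →* SL(2, F) :=
  { toFun := fun x => (-1) ^ (Multiplicative.toAdd x).val
    map_one' := by simp
    map_mul' := by
      intro x y
      rw [← pow_add, toAdd_mul, ZMod.val_add]
      exact (pow_eq_pow_mod _ (by simp)).symm }

end Groups

end

/-! ### Extensions by a group of order two -/

section DoubleCover

variable {E G : Type} [Group E] [Group G] {p : E →* G} {z : E}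

/-! Let `Q = q ^ 2`, so `Q ≡ 1` mod `4`, and let `P` be the kernel of `f`, a copy of `PSL(2, F)`
with double cover `SL(2, F)`.

Two facts about the cover determine the second homology of `P`. First, `SL(2, F)` is perfect with
`H²(SL(2, F), ℤ/2) = 0`. Indeed, the monomial subgroup has odd index and is dicyclic of order `2(Q -
1)`. In the preimage of this subgroup in any double cover of `SL(2, F)`, the kernel avoids the
derived subgroup, so some character is `-1` on the kernel. The transfer keeps this value because the
index is odd, and perfectness makes the transferred character take values in `±1`, so it splits the
cover (`exists_coboundary_of_dicyclic`). Second, a diagonal matrix with entries `i, -i`, where `i² =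
-1`, anticommutes with the Weyl element. By the first fact every cocycle on `P` is a multiple of the
factor set of `SL(2, F)` up to a coboundary; by the second, that factor set is non-trivial on an
integral cycle. Hence evaluating the factor set identifies `H₂(P, ℤ/2)` with `ℤ/2`
(`evalHTwo_bijective`).

The class in `H³(ℤ/2, ℤ/2)` comes down to one sign. Take `s` in `M` outside `P` and a lift `Φ` of
`s²` to `SL(2, F)`; then `s` sends `Φ` to `Φ` or to `-Φ`, and the second case gives the cup cube.
Write `s = tα` with `det t` a non-square, and `t α(t) = uΦ` with a scalar `u`. Then `u² = (det
t)^(q+1)`, so `u^(q-1) = (det t)^((q²-1)/2) = -1`, which means `α(u) = -u`; this is the sign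
(`semiAct_eq_neg`).

Every other obstruction crossed module has the same class. Its factor set agrees with that of `SL(2,
F)` on integral cycles, hence up to a coboundary, which gives a homomorphism from `SL(2, F)` over
`P`. Perfectness makes it equivariant, so the sign is carried over (`map_obstruction`). The classes
are compared by an explicit functional `invariant` on 3-cochains of the group of order two, defined
without any normalization. -/

theorem commute_of_ker_pair (hz : z ≠ 1) (hk : ∀ x, p x = 1 ↔ x = 1 ∨ x = z) (x : E) :
    Commute x z := by
  have h : p (x * z * x⁻¹) = 1 := by simp [(hk z).2 (Or.inr rfl)]
  rcases (hk _).1 h with h | h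
  · exact absurd (by simpa using h) hz
  · exact mul_inv_eq_iff_eq_mul.1 h

theorem mul_self_of_ker_pair (hz : z ≠ 1) (hk : ∀ x, p x = 1 ↔ x = 1 ∨ x = z) : z * z = 1 := by
  have hz1 := (hk z).2 (Or.inr rfl)
  rcases (hk (z * z)).1 (by simp [hz1]) with h | h
  · exact h
  · exact absurd (by simpa using h) hz

/-- A character of order two on the preimage of a subgroup of odd index that is faithful on
the kernel extends to the whole group, up to the action of the transfer. -/
theorem exists_hom_of_odd_index [Finite E] (hp : Function.Surjective p) (hz : z ≠ 1)
    (hk : ∀ x, p x = 1 ↔ x = 1 ∨ x = z) (hperf : commutator G = ⊤)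
    (H : Subgroup G) (hodd : Odd H.index) (hzH : z ∈ H.comap p)
    (φ : H.comap p →* ℂˣ) (hφ : φ ⟨z, hzH⟩ = -1) :
    ∃ V : E →* ℂˣ, V z = -1 ∧ ∀ x, V x = 1 ∨ V x = -1 := by
  have hcomm := commute_of_ker_pair hz hk
  have hVz : MonoidHom.transfer φ z = -1 := by
    -- On a central element the transfer is the power of `φ` by the index, here `(-1)` to an odd
    -- power.
    rw [MonoidHom.transfer_eq_pow φ z fun k g _ => by
      rw [mul_assoc, ← ((hcomm g).pow_right k).eq, inv_mul_cancel_left]]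
    have h : (⟨z ^ (H.comap p).index, MonoidHom.transfer_eq_pow_aux z fun k g _ => by
        rw [mul_assoc, ← ((hcomm g).pow_right k).eq, inv_mul_cancel_left]⟩ : H.comap p) =
        ⟨z, hzH⟩ ^ (H.comap p).index := rfl
    rw [h, map_pow, hφ, H.index_comap_of_surjective hp]
    exact hodd.neg_one_pow
  refine ⟨MonoidHom.transfer φ, hVz, fun x => ?_⟩
  set V := MonoidHom.transfer φ
  -- The square of `V` is trivial on the kernel of `p`, so it descends to the perfect group `G` and
  -- is trivial.
  let W : E →* ℂˣ := (powMonoidHom 2).comp V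
  have hW : p.ker ≤ W.ker := fun y hy => by
    rcases (hk y).1 hy with rfl | rfl
    · simp
    · simp [W, MonoidHom.mem_ker, hVz]
  let W' : G →* ℂˣ := p.liftOfSurjective hp ⟨W, hW⟩
  have h1 : W' (p x) = W x := MonoidHom.liftOfRightInverse_comp_apply _ _ _ ⟨W, hW⟩ x
  have h2 : W' (p x) = 1 := by
    have : p x ∈ commutator G := hperf ▸ Subgroup.mem_top _
    exact Abelianization.commutator_subset_ker W' this
  have h3 : V x ^ 2 = 1 := h1.symm.trans h2
  have h4 : ((V x : ℂˣ) : ℂ) ^ 2 = 1 := by rw [← Units.val_pow_eq_pow_val, h3, Units.val_one]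
  rcases mul_self_eq_one_iff.1 ((pow_two _).symm.trans h4) with h | h
  · exact Or.inl (Units.ext h)
  · exact Or.inr (Units.ext (by simpa using h))

/-- In a double cover of a group with a dicyclic subgroup `H` of order `4n`, `n` even, the
kernel is not contained in the derived subgroup of the preimage of `H`. -/
theorem exists_character_of_dicyclic [Finite E] (hp : Function.Surjective p) (hz : z ≠ 1)
    (hk : ∀ x, p x = 1 ↔ x = 1 ∨ x = z) (H : Subgroup G) (t w : G) (n : ℕ) (hn : Even n)
    (ht : orderOf t = 2 * n) (hw : w * w = t ^ n) (hwt : w * t * w⁻¹ = t⁻¹)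
    (hH : ∀ x ∈ H, x ∈ Subgroup.zpowers t ∨ x * w⁻¹ ∈ Subgroup.zpowers t)
    (hzH : z ∈ H.comap p) :
    ∃ φ : H.comap p →* ℂˣ, φ ⟨z, hzH⟩ = -1 := by
  have hcomm := commute_of_ker_pair hz hk
  have hzz := mul_self_of_ker_pair hz hk
  have hcen : ∀ {x}, p x = 1 → ∀ y, y * x = x * y := fun {x} hx y => by
    rcases (hk x).1 hx with rfl | rfl
    · simp
    · exact hcomm y
  have hsq : ∀ {x}, p x = 1 → x * x = 1 := fun {x} hx => by
    rcases (hk x).1 hx with rfl | rfl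
    · simp
    · exact hzz
  obtain ⟨τ, hτ⟩ := hp t
  obtain ⟨ω, hω⟩ := hp w
  -- As `w` inverts `t`, the lift `ω` inverts `τ` up to an error `a` in the central kernel of order
  -- two.
  obtain ⟨a, ha⟩ : ∃ a, a = ω * τ * ω⁻¹ * τ := ⟨_, rfl⟩
  have hpa : p a = 1 := by rw [ha]; simp [hτ, hω, hwt]
  have haτ : ω * τ * ω⁻¹ = τ⁻¹ * a := by
    rw [hcen hpa, ha]; group
  have hac : Commute τ⁻¹ a := hcen hpa _
  have hcj : ∀ i : ℤ, ω * τ ^ i * ω⁻¹ = τ⁻¹ ^ i * a ^ i := fun i => by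
    rw [← conj_zpow, haτ, hac.mul_zpow]
  -- `κ` is the commutator of `ω` and `τ`; its powers turn out to contain all commutators of the
  -- preimage of `H`.
  obtain ⟨κ, hκ⟩ : ∃ κ, κ = τ⁻¹ * τ⁻¹ * a := ⟨_, rfl⟩
  have hκi : ∀ i : ℤ, κ ^ i = τ⁻¹ ^ i * τ⁻¹ ^ i * a ^ i := fun i => by
    rw [hκ, (hac.mul_left hac).mul_zpow, (Commute.refl τ⁻¹).mul_zpow]
  have hdec : ∀ {x}, p x ∈ Subgroup.zpowers t → ∃ i : ℤ, ∃ e, p e = 1 ∧ x = τ ^ i * e := by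
    rintro x ⟨i, hi⟩
    refine ⟨i, (τ ^ i)⁻¹ * x, ?_, by group⟩
    rw [map_mul, map_inv, map_zpow, hτ, ← hi]
    simp
  have hK : ∀ {x}, p x ∈ Subgroup.zpowers t → ω * x * ω⁻¹ * x⁻¹ ∈ Subgroup.zpowers κ := by
    intro x hx
    obtain ⟨i, e, he, rfl⟩ := hdec hx
    refine ⟨i, ?_⟩
    have h1 : ω * (τ ^ i * e) * ω⁻¹ * (τ ^ i * e)⁻¹ = (ω * τ ^ i * ω⁻¹) * (τ ^ i)⁻¹ := by
      rw [mul_inv_rev, show ω * (τ ^ i * e) * ω⁻¹ * (e⁻¹ * (τ ^ i)⁻¹) =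
        ω * τ ^ i * (e * ω⁻¹) * e⁻¹ * (τ ^ i)⁻¹ by group, ← hcen he]
      group
    change κ ^ i = _
    rw [h1, hcj, hκi, mul_assoc, mul_assoc, ← inv_zpow, (hac.zpow_zpow i i).eq]
  have hT : ∀ {x y}, p x ∈ Subgroup.zpowers t → p y ∈ Subgroup.zpowers t → x * y = y * x := by
    intro x y hx hy
    obtain ⟨i, e, he, rfl⟩ := hdec hx
    obtain ⟨j, e', he', rfl⟩ := hdec hy
    have h1 : Commute (τ ^ i) (τ ^ j) := (Commute.refl τ).zpow_zpow i j
    have h2 : ∀ y, Commute y e := hcen he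
    have h3 : ∀ y, Commute y e' := hcen he'
    exact ((h1.mul_right (h3 _)).mul_left (h2 _).symm).eq
  have hcl : ∀ {x}, p x ∈ Subgroup.zpowers t → p (ω * x * ω⁻¹) ∈ Subgroup.zpowers t := by
    rintro x ⟨i, hi⟩
    refine ⟨-i, ?_⟩
    change t ^ (-i) = _
    rw [map_mul, map_mul, map_inv, hω, ← hi, zpow_neg, ← inv_zpow, ← hwt, conj_zpow]
  -- the exponent of `τ`
  have hτn : τ ^ (2 * n) = 1 := by
    -- Since `τ ^ n` is `ω²` up to a central element, `ω` fixes it. Conjugation by `ω` also gives `τ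
    -- ^ (-n) * a ^ n`, and `a ^ n = 1` because `n` is even.
    obtain ⟨e, he⟩ : ∃ e, e = τ ^ n * (ω * ω)⁻¹ := ⟨_, rfl⟩
    have hpe : p e = 1 := by rw [he, map_mul, map_inv, map_mul, map_pow, hτ, hω, hw, mul_inv_cancel]
    have h1 : τ ^ n = e * (ω * ω) := by rw [he]; group
    have h2 : ω * τ ^ n * ω⁻¹ = τ ^ n := by
      rw [h1, ← mul_assoc, hcen hpe]; group
    have h3 := hcj n
    have h4 : a ^ n = 1 := by
      obtain ⟨k, rfl⟩ := hn
      rw [← two_mul, pow_mul, pow_two, hsq hpa, one_pow]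
    simp only [zpow_natCast] at h3
    rw [h2, h4, mul_one] at h3
    rw [two_mul, pow_add]
    nth_rewrite 1 [h3]
    rw [inv_pow, inv_mul_cancel]
  -- `κ ^ i` lies over `t ^ (-2i)`. If that is trivial, then `n` divides `i`, and `κ ^ n = τ ^ (-2n)
  -- * a ^ n = 1`.
  have hzK : z ∉ Subgroup.zpowers κ := by
    rintro ⟨i, hi⟩
    have hi' : κ ^ i = z := hi
    have h1 : t ^ (2 * i) = 1 := by
      have h := congrArg p hi'
      rw [hκi, (hk z).2 (Or.inr rfl)] at h
      simp only [map_mul, map_zpow, map_inv, hτ, hpa, one_zpow, mul_one] at h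
      rw [← zpow_add, inv_zpow, inv_eq_one, ← two_mul] at h
      exact h
    have h2 : (2 * n : ℤ) ∣ 2 * i := by
      have := orderOf_dvd_iff_zpow_eq_one.2 h1
      rwa [ht] at this
    obtain ⟨l, rfl⟩ : (n : ℤ) ∣ i := (mul_dvd_mul_iff_left (by norm_num)).1 h2
    apply hz
    rw [← hi', zpow_mul, hκi]
    simp only [zpow_natCast]
    obtain ⟨k, rfl⟩ := hn
    rw [← pow_add, inv_pow, ← two_mul (k + k), hτn]
    rw [← two_mul, pow_mul a, pow_two, hsq hpa]
    simp
  -- Elements are `u` or `u * ω` with `u` over `⟨t⟩`, and such `u` commute with each other. Each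
  -- commutator thus reduces to `1` or to a commutator of `ω` with an element over `⟨t⟩`, possibly
  -- inverted.
  have hcomm' : ∀ x ∈ H.comap p, ∀ y ∈ H.comap p, x * y * x⁻¹ * y⁻¹ ∈ Subgroup.zpowers κ := by
    have hcase : ∀ x ∈ H.comap p, ∃ u, p u ∈ Subgroup.zpowers t ∧ (x = u ∨ x = u * ω) := by
      intro x hx
      rcases hH _ hx with h | h
      · exact ⟨x, h, Or.inl rfl⟩
      · exact ⟨x * ω⁻¹, by rwa [map_mul, map_inv, hω], Or.inr (by group)⟩
    intro x hx y hy
    obtain ⟨u, hu, rfl | rfl⟩ := hcase x hx <;> obtain ⟨v, hv, rfl | rfl⟩ := hcase y hy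
    · rw [hT hu hv]; simp
    · have h := Subgroup.inv_mem _ (hK hu)
      convert h using 1
      have : (v * ω) * x⁻¹ * (v * ω)⁻¹ = ω * x⁻¹ * ω⁻¹ := by
        have h1 : p (ω * x⁻¹ * ω⁻¹) ∈ Subgroup.zpowers t :=
          hcl (by rw [map_inv]; exact Subgroup.inv_mem _ hu)
        rw [mul_inv_rev, show v * ω * x⁻¹ * (ω⁻¹ * v⁻¹) = v * (ω * x⁻¹ * ω⁻¹) * v⁻¹ by group,
          hT hv h1]
        group
      calc x * (v * ω) * x⁻¹ * (v * ω)⁻¹ = x * ((v * ω) * x⁻¹ * (v * ω)⁻¹) := by group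
        _ = _ := by rw [this]; group
    · have h := hK hv
      convert h using 1
      have h1 := hcl hv
      rw [mul_inv_rev, show u * ω * y * (ω⁻¹ * u⁻¹) * y⁻¹ =
        u * (ω * y * ω⁻¹) * u⁻¹ * y⁻¹ by group, hT hu h1]
      group
    · have hd : p (v * u⁻¹) ∈ Subgroup.zpowers t := by
        rw [map_mul, map_inv]
        exact Subgroup.mul_mem _ hv (Subgroup.inv_mem _ hu)
      have h := hK hd
      convert h using 1
      have h1 := hcl hd
      calc u * ω * (v * ω) * (u * ω)⁻¹ * (v * ω)⁻¹
          = u * (ω * (v * u⁻¹) * ω⁻¹) * v⁻¹ := by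
            group
        _ = _ := by rw [hT hu h1]; group
  have hnc : (⟨z, hzH⟩ : H.comap p) ∉ commutator (H.comap p) := by
    intro h
    have hle : commutator (H.comap p) ≤ (Subgroup.zpowers κ).subgroupOf (H.comap p) := by
      rw [commutator_def, Subgroup.commutator_le]
      intro x _ y _
      exact hcomm' x x.2 y y.2
    exact hzK (hle h)
  have hne : Abelianization.of (⟨z, hzH⟩ : H.comap p) ≠ 1 := by
    intro h
    exact hnc ((QuotientGroup.eq_one_iff _).1 h)
  -- Characters of a finite abelian group separate points; as `z² = 1`, a non-trivial value at `z`
  -- is `-1`.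
  obtain ⟨φ, hφ⟩ := CommGroup.exists_apply_ne_one_of_hasEnoughRootsOfUnity
    (Abelianization (H.comap p)) ℂ hne
  refine ⟨φ.comp Abelianization.of, ?_⟩
  have h3 : (φ.comp Abelianization.of) ⟨z, hzH⟩ ^ 2 = 1 := by
    rw [← map_pow, show (⟨z, hzH⟩ : H.comap p) ^ 2 = 1 from Subtype.ext (by simp [pow_two, hzz]),
      map_one]
  have h4 : (((φ.comp Abelianization.of) ⟨z, hzH⟩ : ℂˣ) : ℂ) ^ 2 = 1 := by
    rw [← Units.val_pow_eq_pow_val, h3, Units.val_one]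
  rcases mul_self_eq_one_iff.1 ((pow_two _).symm.trans h4) with h | h
  · exact absurd (Units.ext h) hφ
  · exact Units.ext (by simpa using h)

end DoubleCover

/-! ### Two-cocycles with values in `ℤ/2` -/

section Cocycles

/-- `c` is a `2`-cocycle on `G` with values in the trivial module `ℤ/2`. -/
def IsTwoCocycle {G : Type} [Group G] (c : G → G → ZMod 2) : Prop :=
  ∀ x y z, c x y + c (x * y) z = c y z + c x (y * z)

/-- The set underlying the extension of `G` by `ℤ/2` with the factor set `c`. -/
@[ext] structure TwistedProd {G : Type} (c : G → G → ZMod 2) where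
  fst : G
  snd : ZMod 2

namespace TwistedProd

variable {G : Type} [Group G] {c : G → G → ZMod 2}

theorem cocycle_one_left (hc : IsTwoCocycle c) (x : G) : c 1 x = c 1 1 := by
  have h := hc 1 1 x
  simp only [one_mul] at h
  linear_combination -h

instance : Mul (TwistedProd c) := ⟨fun x y => ⟨x.fst * y.fst, x.snd + y.snd + c x.fst y.fst⟩⟩
-- Cocycles are not assumed normalized, which moves the identity and the inverses by `c 1 1`.
instance : One (TwistedProd c) := ⟨⟨1, -c 1 1⟩⟩
instance : Inv (TwistedProd c) := ⟨fun x => ⟨x.fst⁻¹, -x.snd - c x.fst⁻¹ x.fst - c 1 1⟩⟩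

@[simp] theorem fst_mul (x y : TwistedProd c) : (x * y).fst = x.fst * y.fst := rfl
@[simp] theorem snd_mul (x y : TwistedProd c) :
    (x * y).snd = x.snd + y.snd + c x.fst y.fst := rfl
@[simp] theorem fst_one : (1 : TwistedProd c).fst = 1 := rfl
@[simp] theorem snd_one : (1 : TwistedProd c).snd = -c 1 1 := rfl
@[simp] theorem fst_inv (x : TwistedProd c) : x⁻¹.fst = x.fst⁻¹ := rfl
@[simp] theorem snd_inv (x : TwistedProd c) :
    x⁻¹.snd = -x.snd - c x.fst⁻¹ x.fst - c 1 1 := rfl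

/-- The extension of `G` by `ℤ/2` with the factor set `c`. -/
abbrev group (hc : IsTwoCocycle c) : Group (TwistedProd c) :=
  Group.ofLeftAxioms
    (fun x y z => TwistedProd.ext (mul_assoc _ _ _) (by
      simp only [snd_mul, fst_mul]
      linear_combination hc x.fst y.fst z.fst))
    (fun x => TwistedProd.ext (one_mul _) (by
      simp only [snd_mul, snd_one, fst_one, cocycle_one_left hc x.fst]; ring))
    (fun x => TwistedProd.ext (inv_mul_cancel _) (by
      simp only [snd_mul, snd_one, snd_inv, fst_inv]; ring))

instance [Finite G] : Finite (TwistedProd c) :=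
  Finite.of_injective (fun x => (x.fst, x.snd)) fun _ _ h =>
    TwistedProd.ext (congrArg Prod.fst h) (congrArg Prod.snd h)

end TwistedProd

/-- Every `ℤ/2`-valued `2`-cocycle on a finite perfect group with a dicyclic subgroup of odd
index and order divisible by eight is a coboundary. -/
theorem exists_coboundary_of_dicyclic {G : Type} [Group G] [Finite G]
    (hperf : commutator G = ⊤) (H : Subgroup G) (hodd : Odd H.index) (t w : G) (n : ℕ)
    (hn : Even n) (ht : orderOf t = 2 * n) (hw : w * w = t ^ n) (hwt : w * t * w⁻¹ = t⁻¹)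
    (hH : ∀ x ∈ H, x ∈ Subgroup.zpowers t ∨ x * w⁻¹ ∈ Subgroup.zpowers t)
    {c : G → G → ZMod 2} (hc : IsTwoCocycle c) :
    ∃ b : G → ZMod 2, ∀ x y, c x y = b x + b y - b (x * y) := by
  let _ := TwistedProd.group hc
  let p : TwistedProd c →* G := ⟨⟨TwistedProd.fst, rfl⟩, fun _ _ => rfl⟩
  have hp : Function.Surjective p := fun g => ⟨⟨g, 0⟩, rfl⟩
  let z : TwistedProd c := ⟨1, 1 - c 1 1⟩
  have hz : z ≠ 1 := by
    intro h
    have h1 : (1 : ZMod 2) - c 1 1 = -c 1 1 := congrArg TwistedProd.snd h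
    have h2 : (1 : ZMod 2) = 0 := by linear_combination h1
    exact one_ne_zero h2
  have hk : ∀ x, p x = 1 ↔ x = 1 ∨ x = z := by
    intro x
    constructor
    · intro h
      have h2 : ∀ a : ZMod 2, a = 0 ∨ a = 1 := by decide
      rcases h2 (x.snd + c 1 1) with h3 | h3
      · exact Or.inl (TwistedProd.ext h (by rw [TwistedProd.snd_one]; linear_combination h3))
      · exact Or.inr (TwistedProd.ext h (by
          change x.snd = 1 - c 1 1; linear_combination h3))
    · rintro (rfl | rfl) <;> rfl
  have hzH : z ∈ H.comap p := H.one_mem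
  obtain ⟨φ, hφ⟩ := exists_character_of_dicyclic hp hz hk H t w n hn ht hw hwt hH hzH
  obtain ⟨V, hVz, hV⟩ := exists_hom_of_odd_index hp hz hk hperf H hodd hzH φ hφ
  have hne : (-1 : ℂˣ) ≠ 1 := by
    intro h
    have := congrArg Units.val h
    norm_num at this
  classical
  -- `e` identifies `{1, -1}` with `ℤ/2`; it is additive only on these two values.
  let e : ℂˣ → ZMod 2 := fun v => if v = 1 then 0 else 1
  have he : ∀ v v' : ℂˣ, (v = 1 ∨ v = -1) → (v' = 1 ∨ v' = -1) → e (v * v') = e v + e v' := by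
    have h11 : (1 : ZMod 2) + 1 = 0 := by decide
    rintro v v' (rfl | rfl) (rfl | rfl) <;> simp [e, hne, h11]
  let s : G → TwistedProd c := fun g => ⟨g, 0⟩
  have hs : ∀ x y, s x * s y = (⟨1, c x y - c 1 1⟩ : TwistedProd c) * s (x * y) := by
    intro x y
    refine TwistedProd.ext (by simp [s]) ?_
    simp only [TwistedProd.snd_mul, s, TwistedProd.cocycle_one_left hc (x * y)]
    ring
  have hcz : ∀ a : ZMod 2, e (V ⟨1, a - c 1 1⟩) = a := by
    have h2 : ∀ a : ZMod 2, a = 0 ∨ a = 1 := by decide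
    intro a
    rcases h2 a with rfl | rfl
    · have : (⟨1, 0 - c 1 1⟩ : TwistedProd c) = 1 :=
        TwistedProd.ext rfl (by rw [TwistedProd.snd_one]; ring)
      rw [this, map_one]; simp [e]
    · change e (V z) = 1
      rw [hVz]; simp [e, hne]
  -- `e ∘ V` restricts to the identity on the kernel `ℤ/2`, so applying it to the factor set
  -- relation `hs` displays `c` as a coboundary.
  refine ⟨fun g => e (V (s g)), fun x y => ?_⟩
  have h := congrArg (fun g => e (V g)) (hs x y)
  simp only [map_mul] at h
  rw [he _ _ (hV _) (hV _), he _ _ (hV _) (hV _), hcz] at h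
  linear_combination -h

end Cocycles

noncomputable section

/-! ### The monomial subgroup of `SL(2, F)` -/

namespace SLTwo

variable {F : Type} [Field F]

/-- The diagonal torus of `SL(2, F)`. -/
def torus (F : Type) [Field F] : Fˣ →* SL(2, F) where
  toFun u := ⟨!![(u : F), 0; 0, (u⁻¹ : Fˣ)], by simp⟩
  map_one' := Subtype.ext (by
    change !![((1 : Fˣ) : F), 0; 0, ((1⁻¹ : Fˣ) : F)] = 1
    simp [Matrix.one_fin_two])
  map_mul' u v := Subtype.ext (by
    change !![((u * v : Fˣ) : F), 0; 0, (((u * v)⁻¹ : Fˣ) : F)] =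
      !![(u : F), 0; 0, (u⁻¹ : Fˣ)] * !![(v : F), 0; 0, (v⁻¹ : Fˣ)]
    simp [mul_comm])

/-- The Weyl element of `SL(2, F)`. -/
def weyl (F : Type) [Field F] : SL(2, F) := ⟨!![0, 1; -1, 0], by simp⟩

theorem coe_torus (u : Fˣ) :
    (torus F u : Matrix (Fin 2) (Fin 2) F) = !![(u : F), 0; 0, (u⁻¹ : Fˣ)] := rfl

theorem coe_weyl : (weyl F : Matrix (Fin 2) (Fin 2) F) = !![0, 1; -1, 0] := rfl

theorem torus_injective : Function.Injective (torus F) := fun u v h => by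
  have := congrArg (fun x : SL(2, F) => (x : Matrix (Fin 2) (Fin 2) F) 0 0) h
  exact Units.ext (by simpa [coe_torus] using this)

theorem torus_neg_one : torus F (-1) = -1 := by
  refine Subtype.ext ?_
  rw [Matrix.SpecialLinearGroup.coe_neg, coe_torus, Matrix.SpecialLinearGroup.coe_one]
  simp [Matrix.one_fin_two]

theorem weyl_mul_self : weyl F * weyl F = -1 := by
  refine Subtype.ext ?_
  rw [Matrix.SpecialLinearGroup.coe_neg, Matrix.SpecialLinearGroup.coe_mul, coe_weyl,
    Matrix.SpecialLinearGroup.coe_one]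
  simp [Matrix.one_fin_two]

theorem weyl_mul_torus (u : Fˣ) : weyl F * torus F u = torus F u⁻¹ * weyl F := by
  refine Subtype.ext ?_
  rw [Matrix.SpecialLinearGroup.coe_mul, Matrix.SpecialLinearGroup.coe_mul, coe_weyl,
    coe_torus, coe_torus]
  simp

theorem weyl_notMem : weyl F ∉ (torus F).range := by
  rintro ⟨u, hu⟩
  have := congrArg (fun x : SL(2, F) => (x : Matrix (Fin 2) (Fin 2) F) 0 0) hu
  simp [coe_torus, coe_weyl] at this

theorem weyl_inv : (weyl F)⁻¹ = torus F (-1) * weyl F := by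
  rw [inv_eq_iff_mul_eq_one, ← mul_assoc, weyl_mul_torus, mul_assoc, weyl_mul_self, inv_neg,
    inv_one, torus_neg_one]
  simp

/-- The monomial subgroup of `SL(2, F)`. -/
def monomial (F : Type) [Field F] : Subgroup SL(2, F) where
  carrier := {x | ∃ u, x = torus F u ∨ x = torus F u * weyl F}
  one_mem' := ⟨1, Or.inl (map_one _).symm⟩
  mul_mem' := by
    rintro x y ⟨u, rfl | rfl⟩ ⟨v, rfl | rfl⟩
    · exact ⟨u * v, Or.inl (map_mul _ _ _).symm⟩
    · exact ⟨u * v, Or.inr (by rw [map_mul, mul_assoc])⟩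
    · exact ⟨u * v⁻¹, Or.inr (by rw [map_mul, mul_assoc, weyl_mul_torus, mul_assoc])⟩
    · refine ⟨u * v⁻¹ * -1, Or.inl ?_⟩
      rw [map_mul, map_mul, torus_neg_one, mul_assoc, ← mul_assoc (weyl F), weyl_mul_torus,
        mul_assoc (torus F v⁻¹), weyl_mul_self, mul_assoc]
  inv_mem' := by
    rintro x ⟨u, rfl | rfl⟩
    · exact ⟨u⁻¹, Or.inl (map_inv _ _).symm⟩
    · refine ⟨-1 * u, Or.inr ?_⟩
      rw [mul_inv_rev, weyl_inv, ← map_inv, mul_assoc, weyl_mul_torus, inv_inv, map_mul, mul_assoc]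

theorem torus_range_le : (torus F).range ≤ monomial F := by
  rintro _ ⟨u, rfl⟩
  exact ⟨u, Or.inl rfl⟩

theorem relIndex_torus : (torus F).range.relIndex (monomial F) = 2 := by
  rw [Subgroup.relIndex, Subgroup.index_eq_two_iff]
  refine ⟨⟨weyl F, 1, Or.inr (by simp)⟩, ?_⟩
  rintro ⟨x, u, rfl | rfl⟩
  · refine Or.inr ⟨⟨u, rfl⟩, fun h => weyl_notMem (F := F) ?_⟩
    have h' : torus F u * weyl F ∈ (torus F).range := h
    exact ((torus F).range.mul_mem_cancel_left (MonoidHom.mem_range.2 ⟨u, rfl⟩)).1 h'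
  · refine Or.inl ⟨⟨u * -1, ?_⟩, fun h => weyl_notMem (F := F) ?_⟩
    · change _ = torus F u * weyl F * weyl F
      rw [mul_assoc, weyl_mul_self, map_mul, torus_neg_one]
    · have h' : torus F u * weyl F ∈ (torus F).range := h
      exact ((torus F).range.mul_mem_cancel_left (MonoidHom.mem_range.2 ⟨u, rfl⟩)).1 h'

/-- `SL(2, F)` is the kernel of the determinant, which maps `GL(2, F)` onto the units of `F`. -/
theorem card_mul [Fintype F] : Nat.card SL(2, F) * (Fintype.card F - 1) =
    (Fintype.card F ^ 2 - 1) * (Fintype.card F ^ 2 - Fintype.card F) := by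
  have h1 := Matrix.card_GL_field (𝔽 := F) 2
  rw [Fin.prod_univ_two] at h1
  simp only [Fin.val_zero, Fin.val_one, pow_zero, pow_one] at h1
  rw [← h1, ← (Matrix.GeneralLinearGroup.det (n := Fin 2) (R := F)).ker.card_mul_index,
    Subgroup.index_ker, MonoidHom.range_eq_top.2 Matrix.GeneralLinearGroup.det_surjective,
    Subgroup.card_top, Nat.card_units, Nat.card_eq_fintype_card (α := F)]
  congr 1
  refine Nat.card_congr (Equiv.ofBijective (fun x : SL(2, F) =>
    (⟨Matrix.SpecialLinearGroup.toGL x, Units.ext x.2⟩ :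
      (Matrix.GeneralLinearGroup.det (n := Fin 2) (R := F)).ker)) ⟨?_, ?_⟩)
  · intro x y h
    exact Subtype.ext (congrArg (fun g => (g.1.1 : Matrix (Fin 2) (Fin 2) F)) h)
  · rintro ⟨g, hg⟩
    exact ⟨⟨g.1, congrArg Units.val hg⟩, Subtype.ext (Units.ext rfl)⟩

/-- The monomial subgroup has order `2(Q - 1)`, so its index is `Q(Q + 1)/2`. For `Q = 4k + 1` this
is `(2k + 1)(4k + 1)`. -/
theorem odd_index_monomial [Fintype F] (hQ : Fintype.card F % 4 = 1) :
    Odd (monomial F).index := by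
  have hT : Nat.card (torus F).range = Fintype.card F - 1 := by
    rw [← Nat.card_congr (MonoidHom.ofInjective torus_injective).toEquiv, Nat.card_units,
      Nat.card_eq_fintype_card]
  have h1 := (torus F).range.card_mul_index
  rw [← Subgroup.relIndex_mul_index torus_range_le, relIndex_torus, hT] at h1
  have h2 := card_mul (F := F)
  rw [← h1] at h2
  have h3 : 1 < Fintype.card F := Fintype.one_lt_card
  generalize Fintype.card F = Q at *
  obtain ⟨k, rfl⟩ : ∃ k, Q = 4 * k + 1 := ⟨Q / 4, by omega⟩
  have hk : 0 < k := by omega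
  have h4 : (4 * k + 1) ^ 2 - 1 = 4 * k * (2 * (2 * k + 1)) := by
    rw [Nat.sub_eq_iff_eq_add (Nat.one_le_pow _ _ (by omega))]; ring
  have h5 : (4 * k + 1) ^ 2 - (4 * k + 1) = 4 * k * (4 * k + 1) := by
    rw [Nat.sub_eq_iff_eq_add (Nat.le_self_pow (by norm_num) _)]; ring
  rw [h4, h5, Nat.add_sub_cancel] at h2
  have h6 : (monomial F).index = (2 * k + 1) * (4 * k + 1) := by
    have h7 : 2 * (4 * k * (4 * k)) * (monomial F).index =
        2 * (4 * k * (4 * k)) * ((2 * k + 1) * (4 * k + 1)) := by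
      linear_combination h2
    exact Nat.eq_of_mul_eq_mul_left (by positivity) h7
  rw [h6]
  exact (odd_two_mul_add_one k).mul ⟨2 * k, by ring⟩

/-- It suffices to have a unit whose square is not `1`; a generator of the unit group has order `Q -
1 ≥ 4`. -/
theorem commutator_eq_top [Fintype F] (hQ : Fintype.card F % 4 = 1) :
    commutator SL(2, F) = ⊤ := by
  have h3 : 1 < Fintype.card F := Fintype.one_lt_card
  obtain ⟨g, hg⟩ := IsCyclic.exists_generator (α := Fˣ)
  have ho := orderOf_eq_card_of_forall_mem_zpowers hg
  rw [Nat.card_units, Nat.card_eq_fintype_card] at ho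
  refine Matrix.SL2.commutator_eq_top g.ne_zero fun h => ?_
  have : orderOf g ∣ 2 := orderOf_dvd_of_pow_eq_one (Units.ext (by simpa using h))
  have := Nat.le_of_dvd (by norm_num) this
  omega

/-- `H²(SL(2, F), ℤ/2) = 0`. -/
theorem exists_coboundary [Fintype F] (hQ : Fintype.card F % 4 = 1)
    {c : SL(2, F) → SL(2, F) → ZMod 2} (hc : IsTwoCocycle c) :
    ∃ b : SL(2, F) → ZMod 2, ∀ x y, c x y = b x + b y - b (x * y) := by
  have h3 : 1 < Fintype.card F := Fintype.one_lt_card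
  obtain ⟨g, hg⟩ := IsCyclic.exists_generator (α := Fˣ)
  have ho := orderOf_eq_card_of_forall_mem_zpowers hg
  rw [Nat.card_units, Nat.card_eq_fintype_card] at ho
  -- The cyclic part of the dicyclic group is the torus, of order `Q - 1 = 2n`; `n` is even because
  -- `Q ≡ 1` mod `4`.
  obtain ⟨n, hn⟩ : ∃ n, Fintype.card F - 1 = 2 * n := ⟨Fintype.card F / 2, by omega⟩
  have hgn : g ^ n = -1 := by
    have h1 : ((g ^ n : Fˣ) : F) * ((g ^ n : Fˣ) : F) = 1 := by
      rw [← Units.val_mul, ← pow_add, ← two_mul, ← hn, ← ho, pow_orderOf_eq_one, Units.val_one]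
    rcases mul_self_eq_one_iff.1 h1 with h | h
    · have := Nat.le_of_dvd (by omega) (orderOf_dvd_of_pow_eq_one (Units.ext h))
      omega
    · exact Units.ext (by simpa using h)
  have hz : ∀ u, torus F u ∈ Subgroup.zpowers (torus F g) := by
    intro u
    obtain ⟨i, rfl⟩ := hg u
    exact ⟨i, (map_zpow _ _ _).symm⟩
  refine exists_coboundary_of_dicyclic (commutator_eq_top hQ) (monomial F)
    (odd_index_monomial hQ) (torus F g) (weyl F) n (Nat.even_iff.2 (by omega)) ?_ ?_ ?_ ?_ hc
  · rw [orderOf_injective _ torus_injective, ho, hn]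
  · rw [← map_pow, hgn, torus_neg_one, weyl_mul_self]
  · rw [weyl_mul_torus, mul_inv_cancel_right, map_inv]
  · rintro x ⟨u, rfl | rfl⟩
    · exact Or.inl (hz u)
    · exact Or.inr (by rw [mul_inv_cancel_right]; exact hz u)

end SLTwo

/-! ### Evaluating `2`-cocycles on `H₂(P, ℤ/2)` -/

section Evaluation

variable {P : Type}

/-- The pairing of a `2`-cochain with `2`-chains. -/
def evalChain (u : P → P → ZMod 2) : (P × P →₀ ZMod 2) →ₗ[ℤ] ZMod 2 :=
  Finsupp.lsum ℤ fun xy => (AddMonoidHom.mulRight (u xy.1 xy.2)).toIntLinearMap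

theorem evalChain_single (u : P → P → ZMod 2) (xy : P × P) (a : ZMod 2) :
    evalChain u (Finsupp.single xy a) = a * u xy.1 xy.2 := by
  simp [evalChain]

/-- Reduction modulo two on chains. -/
def reduceChain (P : Type) : (P × P →₀ ℤ) →ₗ[ℤ] (P × P →₀ ZMod 2) :=
  Finsupp.mapRange.linearMap (zmultiplesHom (ZMod 2) 1).toIntLinearMap

theorem evalChain_reduceChain (u : P → P → ZMod 2) (z : P × P →₀ ℤ) :
    evalChain u (reduceChain P z) = z.sum fun xy n => n • u xy.1 xy.2 := by
  induction z using Finsupp.induction_linear with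
  | zero => simp
  | add a b ha hb =>
    rw [map_add, map_add, ha, hb, Finsupp.sum_add_index' (by simp) (by simp [add_mul])]
  | single x a => simp [reduceChain, evalChain_single]

variable [Group P]

theorem d₃₂_trivial_single {A : Type} [AddCommGroup A] (x y w : P) (a : A) :
    (groupHomology.d₃₂ (Rep.trivial ℤ P A)).hom (Finsupp.single (x, y, w) a) =
      Finsupp.single (y, w) a - Finsupp.single (x * y, w) a +
        Finsupp.single (x, y * w) a - Finsupp.single (x, y) a :=
  groupHomology.d₃₂_single (A := Rep.trivial ℤ P A) (x, y, w) a

theorem d₂₁_trivial_single {A : Type} [AddCommGroup A] (x y : P) (a : A) :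
    (groupHomology.d₂₁ (Rep.trivial ℤ P A)).hom (Finsupp.single (x, y) a) =
      Finsupp.single y a - Finsupp.single (x * y) a + Finsupp.single x a :=
  groupHomology.d₂₁_single (A := Rep.trivial ℤ P A) (x, y) a

theorem evalChain_d₃₂ {u : P → P → ZMod 2} (hu : IsTwoCocycle u) (y : P × P × P →₀ ZMod 2) :
    evalChain u ((groupHomology.d₃₂ (Rep.trivial ℤ P (ZMod 2))).hom y) = 0 := by
  induction y using Finsupp.induction_linear with
  | zero => exact (congrArg (evalChain u) (map_zero _)).trans (map_zero _)
  | add a b ha hb =>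
    refine (congrArg (evalChain u) (map_add _ a b)).trans ?_
    refine (map_add (evalChain u) _ _).trans ?_
    rw [ha, hb, add_zero]
  | single x a =>
    obtain ⟨x, y, w⟩ := x
    refine (congrArg (evalChain u) (d₃₂_trivial_single x y w a)).trans ?_
    rw [map_sub, map_add, map_sub]
    simp only [evalChain_single]
    linear_combination -a * hu x y w

/-- The map `H₂(P, ℤ/2) → ℤ/2` given by a `2`-cocycle. -/
def evalHTwo (u : P → P → ZMod 2) (hu : IsTwoCocycle u) : HTwo P (ZMod 2) →ₗ[ℤ] ZMod 2 :=
  ((LinearMap.ker (groupHomology.H2π (Rep.trivial ℤ P (ZMod 2))).hom).liftQ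
    ((evalChain u).comp (groupHomology.cycles₂ (Rep.trivial ℤ P (ZMod 2))).subtype) (by
      intro z hz
      obtain ⟨y, hy⟩ := (groupHomology.H2π_eq_zero_iff z).1 hz
      exact (congrArg (evalChain u) hy.symm).trans (evalChain_d₃₂ hu y))).comp
    ((groupHomology.H2π (Rep.trivial ℤ P (ZMod 2))).hom.quotKerEquivOfSurjective (fun x => by
      induction x using groupHomology.H2_induction_on with
      | h x => exact ⟨x, rfl⟩)).symm.toLinearMap

theorem evalHTwo_H2π {u : P → P → ZMod 2} (hu : IsTwoCocycle u)
    (z : groupHomology.cycles₂ (Rep.trivial ℤ P (ZMod 2))) :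
    evalHTwo u hu (groupHomology.H2π (Rep.trivial ℤ P (ZMod 2)) z) =
      evalChain u (z : P × P →₀ ZMod 2) := by
  have h := LinearMap.quotKerEquivOfSurjective_symm_apply
    (groupHomology.H2π (Rep.trivial ℤ P (ZMod 2))).hom (fun x => by
      induction x using groupHomology.H2_induction_on with
      | h x => exact ⟨x, rfl⟩) z
  exact (congrArg _ h).trans rfl

/-- This turns the clause `classified` of an element central extension into an equation between sums
in `ℤ/2`. -/
theorem evalHTwo_map {u : P → P → ZMod 2} (hu : IsTwoCocycle u)
    (z : groupHomology.cycles₂ (Rep.trivial ℤ P ℤ)) :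
    evalHTwo u hu (HTwo.map (MonoidHom.id P) (zmultiplesHom (ZMod 2) 1)
      (groupHomology.H2π (Rep.trivial ℤ P ℤ) z)) =
        Finsupp.sum (z : P × P →₀ ℤ) fun xy n => n • u xy.1 xy.2 := by
  rw [← evalChain_reduceChain]
  have e := congrArg (fun t => t.hom z)
    (groupHomology.H2π_comp_map (A := Rep.trivial ℤ P ℤ) (B := Rep.trivial ℤ P (ZMod 2))
      (MonoidHom.id P) (Rep.ofHom ⟨(zmultiplesHom (ZMod 2) 1).toIntLinearMap, fun _ => rfl⟩))
  refine (congrArg (evalHTwo u hu) e).trans ?_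
  refine (evalHTwo_H2π hu _).trans (congrArg (evalChain u) ?_)
  exact congrArg (reduceChain P) (Finsupp.mapDomain_id (v := (z : P × P →₀ ℤ)))

/-- The `2`-cycle `(x, y) - (y, x)` for commuting elements `x` and `y`. -/
def commCycle (A : Type) [AddCommGroup A] (x y : P) (h : x * y = y * x) (a : A) :
    groupHomology.cycles₂ (Rep.trivial ℤ P A) :=
  ⟨(Finsupp.single (x, y) a - Finsupp.single (y, x) a : P × P →₀ A), by
    refine (map_sub (groupHomology.d₂₁ (Rep.trivial ℤ P A)).hom _ _).trans ?_
    refine (congrArg₂ (· - ·) (d₂₁_trivial_single x y a) (d₂₁_trivial_single y x a)).trans ?_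
    rw [h]
    change (_ - _ : P →₀ A) = 0
    abel⟩

end Evaluation

/-! ### `H₂(P, ℤ/2)` for a group with a double cover without second cohomology -/

/-- `ζ : ℤ/2 → S` and `p : S → P` form a double cover of `P` by a perfect group `S` with
`H²(S, ℤ/2) = 0`, in which some commuting elements of `P` do not lift to commuting elements. -/
structure IsSchurDoubleCover {S P : Type} [Group S] [Group P] (ζ : CTwo →* S) (p : S →* P) :
    Prop where
  surjective : Function.Surjective p
  injective : Function.Injective ζ
  exact : ζ.range = p.ker
  central : ∀ a s, s * ζ a = ζ a * s
  perfect : commutator S = ⊤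
  coboundary : ∀ c : S → S → ZMod 2, IsTwoCocycle c →
    ∃ b : S → ZMod 2, ∀ x y, c x y = b x + b y - b (x * y)
  pair : ∃ X Y : S, X * Y = ζ (Multiplicative.ofAdd 1) * (Y * X)

/-- `u` is the factor set of the section `σ` of `p`. -/
structure IsFactorSet {S P : Type} [Group S] [Group P] (ζ : CTwo →* S) (p : S →* P)
    (σ : P → S) (u : P → P → ZMod 2) : Prop where
  section' : ∀ x, p (σ x) = x
  mul : ∀ x y, σ x * σ y = ζ (Multiplicative.ofAdd (u x y)) * σ (x * y)

namespace IsSchurDoubleCover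

variable {S P : Type} [Group S] [Group P] {ζ : CTwo →* S} {p : S →* P}

theorem apply_ker (h : IsSchurDoubleCover ζ p) (a : CTwo) : p (ζ a) = 1 :=
  (h.exact ▸ ⟨a, rfl⟩ : ζ a ∈ p.ker)

theorem exists_of_eq (h : IsSchurDoubleCover ζ p) {x y : S} (hxy : p x = p y) :
    ∃ a : ZMod 2, x = ζ (Multiplicative.ofAdd a) * y := by
  have : x * y⁻¹ ∈ ζ.range := by
    rw [h.exact, MonoidHom.mem_ker, map_mul, map_inv, hxy, mul_inv_cancel]
  obtain ⟨a, ha⟩ := this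
  exact ⟨Multiplicative.toAdd a, by rw [ofAdd_toAdd, ha, inv_mul_cancel_right]⟩

theorem exists_factorSet (h : IsSchurDoubleCover ζ p) : ∃ σ u, IsFactorSet ζ p σ u := by
  choose σ hσ using h.surjective
  have := fun x y => h.exists_of_eq (x := σ x * σ y) (y := σ (x * y)) (by simp [hσ])
  choose u hu using this
  exact ⟨σ, u, hσ, hu⟩

theorem ofAdd_add_mul (a b : ZMod 2) :
    ζ (Multiplicative.ofAdd (a + b)) = ζ (Multiplicative.ofAdd a) * ζ (Multiplicative.ofAdd b) :=
  map_mul ζ _ _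

theorem ofAdd_mul_cancel (h : IsSchurDoubleCover ζ p) {a b : ZMod 2} {s : S}
    (hab : ζ (Multiplicative.ofAdd a) * s = ζ (Multiplicative.ofAdd b) * s) : a = b :=
  Multiplicative.ofAdd.injective (h.injective (mul_right_cancel hab))

variable {σ : P → S} {u : P → P → ZMod 2}

theorem isTwoCocycle (h : IsSchurDoubleCover ζ p) (hu : IsFactorSet ζ p σ u) :
    IsTwoCocycle u := fun x y w => by
  have e := mul_assoc (σ x) (σ y) (σ w)
  rw [hu.mul x y, hu.mul y w, mul_assoc, hu.mul (x * y) w, ← mul_assoc (σ x), h.central,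
    mul_assoc _ (σ x), hu.mul x (y * w), ← mul_assoc, ← mul_assoc, mul_assoc x,
    ← ofAdd_add_mul, ← ofAdd_add_mul] at e
  exact h.ofAdd_mul_cancel e

/-- Up to coboundaries, the factor set spans the `2`-cocycles of `P`. -/
theorem exists_smul_factorSet (h : IsSchurDoubleCover ζ p) (hu : IsFactorSet ζ p σ u)
    {c : P → P → ZMod 2} (hc : IsTwoCocycle c) :
    ∃ (k : ZMod 2) (β : P → ZMod 2), ∀ x y, c x y = β x + β y - β (x * y) + k * u x y := by
  -- The pullback of `c` to `S` is the coboundary of some `b`. The pullback does not see the kernel,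
  -- so translation by a kernel element changes `b` by a constant.
  obtain ⟨b, hb⟩ := h.coboundary (fun X Y => c (p X) (p Y)) fun X Y W => by
    simpa using hc (p X) (p Y) (p W)
  have h2 : ∀ a : ZMod 2, a = 0 ∨ a = 1 := by decide
  have hb1 : ∀ a X, b (ζ (Multiplicative.ofAdd a) * X) =
      b X + a * (b (ζ (Multiplicative.ofAdd 1)) - b 1) := by
    intro a X
    have e1 := hb 1 X
    have e2 := hb (ζ (Multiplicative.ofAdd a)) X
    rw [h.apply_ker] at e2
    rw [map_one, one_mul] at e1
    rcases h2 a with rfl | rfl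
    · rw [ofAdd_zero, map_one]; simp
    · linear_combination e2 - e1
  have hchar : ∀ a : ZMod 2, a + a = 0 := by decide
  -- `k` is the change of `b` under the non-trivial kernel element, and `β` is `b` along the
  -- section.
  refine ⟨b (ζ (Multiplicative.ofAdd 1)) - b 1, fun x => b (σ x), fun x y => ?_⟩
  have e := hb (σ x) (σ y)
  rw [hu.section', hu.section', hu.mul, hb1] at e
  linear_combination e - hchar (u x y * (b (ζ (Multiplicative.ofAdd 1)) - b 1))

/-- For commuting `x` and `y`, the difference `u x y - u y x` is the commutator of their lifts,
which does not depend on the lifts because the kernel is central. -/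
theorem exists_pair_factorSet (h : IsSchurDoubleCover ζ p) (hu : IsFactorSet ζ p σ u) :
    ∃ x y, x * y = y * x ∧ u x y - u y x = 1 := by
  obtain ⟨X, Y, hXY⟩ := h.pair
  have hc : p X * p Y = p Y * p X := by
    have := congrArg p hXY
    rwa [map_mul, map_mul, map_mul, h.apply_ker, one_mul] at this
  refine ⟨p X, p Y, hc, ?_⟩
  obtain ⟨a, ha⟩ := h.exists_of_eq (hu.section' (p X))
  obtain ⟨b, hb⟩ := h.exists_of_eq (hu.section' (p Y))
  have e : σ (p X) * σ (p Y) = ζ (Multiplicative.ofAdd 1) * (σ (p Y) * σ (p X)) := by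
    have hm : ∀ (c d : CTwo) (V W : S), ζ c * V * (ζ d * W) = ζ c * ζ d * (V * W) := by
      intro c d V W
      rw [mul_assoc, ← mul_assoc V, h.central]
      simp only [mul_assoc]
    rw [ha, hb, hm, hm, hXY, ← mul_assoc, ← mul_assoc (ζ _) (ζ _ * ζ _)]
    simp only [← map_mul]
    rw [mul_comm (Multiplicative.ofAdd b), mul_comm (_ * _)]
  rw [hu.mul, hu.mul, hc, ← mul_assoc, ← ofAdd_add_mul] at e
  linear_combination h.ofAdd_mul_cancel e

/-- Injectivity is duality over the field with two elements. A cycle that is no boundary is detected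
by a functional vanishing on boundaries, that is, by a cocycle. This cocycle is a multiple of `u`
plus a coboundary, and coboundaries vanish on cycles, so `u` detects the cycle too. Surjectivity
comes from the cycle of a commuting pair whose lifts do not commute. -/
theorem evalHTwo_bijective (h : IsSchurDoubleCover ζ p) (hu : IsFactorSet ζ p σ u) :
    Function.Bijective (evalHTwo u (h.isTwoCocycle hu)) := by
  have h2 : ∀ a : ZMod 2, a = 0 ∨ a = 1 := by decide
  constructor
  · rw [injective_iff_map_eq_zero]
    intro z hz
    induction z using groupHomology.H2_induction_on with
    | h z =>
    have hz' : evalChain u (z : P × P →₀ ZMod 2) = 0 := (evalHTwo_H2π _ z).symm.trans hz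
    refine (groupHomology.H2π_eq_zero_iff z).2 ?_
    by_contra hcon
    -- The boundary is only `ℤ`-linear as given; separating functionals require linearity over the
    -- field `ZMod 2`.
    let D : (P × P × P →₀ ZMod 2) →+ (P × P →₀ ZMod 2) :=
      (groupHomology.d₃₂ (Rep.trivial ℤ P (ZMod 2))).hom.toAddMonoidHom
    have hcon' : (z : P × P →₀ ZMod 2) ∉ LinearMap.range (D.toZModLinearMap 2) :=
      fun ⟨y, hy⟩ => hcon ⟨y, hy⟩
    obtain ⟨φ, hφz, hφ⟩ := Submodule.exists_le_ker_of_notMem hcon'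
    let c : P → P → ZMod 2 := fun x y => φ (Finsupp.single (x, y) 1)
    have hc : IsTwoCocycle c := fun x y w => by
      have e := hφ ⟨Finsupp.single (x, y, w) 1, rfl⟩
      rw [LinearMap.mem_ker] at e
      have e' := (congrArg φ (d₃₂_trivial_single x y w (1 : ZMod 2))).symm.trans e
      rw [map_sub, map_add, map_sub] at e'
      change c y w - c (x * y) w + c x (y * w) - c x y = 0 at e'
      linear_combination -e'
    have hev : ∀ y : P × P →₀ ZMod 2, φ y = evalChain c y := by
      intro y
      induction y using Finsupp.induction_linear with
      | zero => simp
      | add a b ha hb => rw [map_add, map_add, ha, hb]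
      | single x a =>
        rw [evalChain_single, ← smul_eq_mul, ← map_smul, Finsupp.smul_single, smul_eq_mul, mul_one]
    obtain ⟨k, β, hβ⟩ := h.exists_smul_factorSet hu hc
    let B : (P →₀ ZMod 2) →ₗ[ℤ] ZMod 2 :=
      Finsupp.lsum ℤ fun x => (AddMonoidHom.mulRight (β x)).toIntLinearMap
    have hB : ∀ y : P × P →₀ ZMod 2, evalChain c y =
        B ((groupHomology.d₂₁ (Rep.trivial ℤ P (ZMod 2))).hom y) + k * evalChain u y := by
      intro y
      induction y using Finsupp.induction_linear with
      | zero =>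
        refine Eq.symm ((congrArg (fun t => B t + _) (map_zero _)).trans ?_)
        simp
      | add a b ha hb =>
        refine Eq.symm ((congrArg (fun t => B t + _) (map_add _ a b)).trans ?_)
        refine (congrArg (· + _) (map_add B _ _)).trans ?_
        rw [map_add, map_add, ha, hb]
        ring
      | single x a =>
        obtain ⟨x, y⟩ := x
        refine Eq.symm ((congrArg (fun t => B t + _) (d₂₁_trivial_single x y a)).trans ?_)
        rw [map_add, map_sub, evalChain_single, evalChain_single]
        simp only [B, Finsupp.lsum_single, AddMonoidHom.coe_toIntLinearMap,
          AddMonoidHom.mulRight_apply, hβ]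
        ring
    apply hφz
    rw [hev, hB, hz', mul_zero, add_zero]
    exact (congrArg B z.2).trans (map_zero B)
  · intro a
    obtain ⟨x, y, hxy, hval⟩ := h.exists_pair_factorSet hu
    refine ⟨groupHomology.H2π _ (commCycle (ZMod 2) x y hxy a), ?_⟩
    rw [evalHTwo_H2π]
    refine (map_sub (evalChain u) _ _).trans ?_
    rw [evalChain_single, evalChain_single]
    linear_combination a * hval

/-- A `2`-cocycle that takes the same values as the factor set on integral cycles differs from
it by a coboundary. -/
theorem exists_sub_factorSet (h : IsSchurDoubleCover ζ p) (hu : IsFactorSet ζ p σ u)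
    {c : P → P → ZMod 2} (hc : IsTwoCocycle c)
    (hz : ∀ z : groupHomology.cycles₂ (Rep.trivial ℤ P ℤ),
      (Finsupp.sum (z : P × P →₀ ℤ) fun xy n => n • c xy.1 xy.2) =
        Finsupp.sum (z : P × P →₀ ℤ) fun xy n => n • u xy.1 xy.2) :
    ∃ β : P → ZMod 2, ∀ x y, c x y = β x + β y - β (x * y) + u x y := by
  obtain ⟨k, β, hβ⟩ := h.exists_smul_factorSet hu hc
  obtain ⟨x, y, hxy, hval⟩ := h.exists_pair_factorSet hu
  have hv : ∀ v : P → P → ZMod 2,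
      Finsupp.sum (commCycle ℤ x y hxy 1 : P × P →₀ ℤ) (fun xy n => n • v xy.1 xy.2) =
        v x y - v y x := by
    intro v
    change Finsupp.sum (Finsupp.single (x, y) (1 : ℤ) - Finsupp.single (y, x) 1) _ = _
    rw [Finsupp.sum_sub_index (by intros; simp [sub_mul])]
    simp
  -- The commutator cycle kills the coboundary and takes the value `1` on `u`, so it reads off `k`.
  have e := hz (commCycle ℤ x y hxy 1)
  rw [hv, hv, hβ, hβ, hval, hxy] at e
  have hk : k = 1 := by linear_combination e - k * hval
  exact ⟨β, fun x y => by rw [hβ, hk, one_mul]⟩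

end IsSchurDoubleCover

/-! ### Homomorphisms to the group of order two -/

open Classical in
/-- The homomorphism to `ℤ/2` with kernel `N`, for a subgroup `N` such that the product of two
elements outside `N` lies in `N`. -/
def twoHom {A : Type} [Group A] (N : Subgroup A) (h : ∀ a b, a ∉ N → b ∉ N → a * b ∈ N) :
    A →* CTwo where
  toFun a := if a ∈ N then 1 else Multiplicative.ofAdd 1
  map_one' := if_pos N.one_mem
  map_mul' a b := by
    by_cases ha : a ∈ N
    · by_cases hb : b ∈ N
      · rw [if_pos ha, if_pos hb, if_pos (N.mul_mem ha hb), one_mul]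
      · rw [if_pos ha, if_neg hb, if_neg (mt (N.mul_mem_cancel_left ha).1 hb), one_mul]
    · by_cases hb : b ∈ N
      · rw [if_neg ha, if_pos hb, if_neg (mt (N.mul_mem_cancel_right hb).1 ha), mul_one]
      · rw [if_neg ha, if_neg hb, if_pos (h a b ha hb)]; rfl

theorem twoHom_eq_one {A : Type} [Group A] {N : Subgroup A}
    (h : ∀ a b, a ∉ N → b ∉ N → a * b ∈ N) {a : A} : twoHom N h a = 1 ↔ a ∈ N := by
  classical
  change (if a ∈ N then (1 : CTwo) else Multiplicative.ofAdd 1) = 1 ↔ _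
  split_ifs with ha
  · simp [ha]
  · simp only [ha, iff_false]; decide

theorem CTwo.eq_of_ne_one {a b : CTwo} (ha : a ≠ 1) (hb : b ≠ 1) : a = b := by
  revert a b; decide

theorem CTwo.mul_eq_one {a b : CTwo} (ha : a ≠ 1) (hb : b ≠ 1) : a * b = 1 := by
  revert a b; decide

theorem CTwo.eq_one_or (a : CTwo) : a = 1 ∨ a = Multiplicative.ofAdd 1 := by
  revert a; decide

/-! ### Projective groups and squares -/

section Projective

variable {F : Type} [Field F]

theorem isSquare_mul_of_not [Fintype F] {a b : F} (ha : ¬IsSquare a) (hb : ¬IsSquare b) :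
    IsSquare (a * b) := by
  have h2 : ringChar F ≠ 2 := fun h => ha (FiniteField.isSquare_of_char_two h a)
  have ha0 : a ≠ 0 := fun h => ha (h ▸ IsSquare.zero)
  have hb0 : b ≠ 0 := fun h => hb (h ▸ IsSquare.zero)
  rw [FiniteField.isSquare_iff h2 ha0] at ha
  rw [FiniteField.isSquare_iff h2 hb0] at hb
  rw [FiniteField.isSquare_iff h2 (mul_ne_zero ha0 hb0), mul_pow,
    (FiniteField.pow_dichotomy h2 ha0).resolve_left ha,
    (FiniteField.pow_dichotomy h2 hb0).resolve_left hb]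
  norm_num

theorem mem_range_toPGL_iff_exists {τ : PGL(2, F)} :
    τ ∈ (Matrix.ProjectiveSpecialLinearGroup.toPGL (n := Fin 2) (R := F)).range ↔
      ∃ y : SL(2, F), Matrix.SpecialLinearGroup.toPGL y = τ := by
  constructor
  · rintro ⟨x, rfl⟩
    induction x using QuotientGroup.induction_on with
    | H x => exact ⟨x, rfl⟩
  · rintro ⟨y, rfl⟩
    exact ⟨QuotientGroup.mk y, rfl⟩

/-- The image of `SL(2, F)` in `PGL(2, F)` consists of the classes with square determinant. -/
theorem mk_mem_range_toPGL_iff {g : GL (Fin 2) F} :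
    Matrix.ProjGenLinGroup.mk g ∈
      (Matrix.ProjectiveSpecialLinearGroup.toPGL (n := Fin 2) (R := F)).range ↔
        IsSquare (g.1.det) := by
  rw [mem_range_toPGL_iff_exists]
  constructor
  · rintro ⟨y, hy⟩
    obtain ⟨u, hu⟩ := Matrix.ProjGenLinGroup.mk_eq_mk_iff.1 hy
    refine ⟨u, ?_⟩
    rw [← hu]
    simp [pow_two]
  · rintro ⟨r, hr⟩
    have hdet : g.1.det ≠ 0 := (Matrix.isUnits_det_units g).ne_zero
    have hr0 : r ≠ 0 := fun h => hdet (by rw [hr, h, mul_zero])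
    have h1 : (r⁻¹ • g.1).det = 1 := by
      rw [Matrix.det_smul, hr, Fintype.card_fin]
      field_simp
    refine ⟨⟨r⁻¹ • g.1, h1⟩, ?_⟩
    refine Matrix.ProjGenLinGroup.mk_eq_mk_iff.2 ⟨Units.mk0 r hr0, Units.ext ?_⟩
    ext i j
    change ((r⁻¹ • g.1) * (Matrix.scalar (Fin 2) r)) i j = g.1 i j
    simp [Matrix.mul_apply, Matrix.diagonal_apply, hr0, mul_comm]

theorem galPGL_mem_range_toPGL_iff (σ : RingAut F) {τ : PGL(2, F)} :
    galPGL F σ τ ∈ (Matrix.ProjectiveSpecialLinearGroup.toPGL (n := Fin 2) (R := F)).range ↔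
      τ ∈ (Matrix.ProjectiveSpecialLinearGroup.toPGL (n := Fin 2) (R := F)).range := by
  induction τ using Matrix.ProjGenLinGroup.induction_on with | mk g =>
  change Matrix.ProjGenLinGroup.mk (galGL F σ g) ∈ _ ↔ _
  rw [mk_mem_range_toPGL_iff, mk_mem_range_toPGL_iff]
  have : (galGL F σ g).1.det = σ g.1.det := by
    change (RingEquiv.mapMatrix σ g.1).det = _
    exact (RingEquiv.map_det σ g.1).symm
  rw [this]
  constructor
  · rintro ⟨r, hr⟩
    exact ⟨σ.symm r, by apply σ.injective; rw [hr, map_mul]; simp⟩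
  · rintro ⟨r, hr⟩
    exact ⟨σ r, by rw [hr, map_mul]⟩

variable [Fintype F]

theorem mul_mem_range_toPGL {τ τ' : PGL(2, F)}
    (h : τ ∉ (Matrix.ProjectiveSpecialLinearGroup.toPGL (n := Fin 2) (R := F)).range)
    (h' : τ' ∉ (Matrix.ProjectiveSpecialLinearGroup.toPGL (n := Fin 2) (R := F)).range) :
    τ * τ' ∈ (Matrix.ProjectiveSpecialLinearGroup.toPGL (n := Fin 2) (R := F)).range := by
  induction τ using Matrix.ProjGenLinGroup.induction_on with | mk g =>
  induction τ' using Matrix.ProjGenLinGroup.induction_on with | mk g' =>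
  rw [mk_mem_range_toPGL_iff] at h h'
  rw [← map_mul, mk_mem_range_toPGL_iff, Units.val_mul, Matrix.det_mul]
  exact isSquare_mul_of_not h h'

/-- The class of the determinant modulo squares. -/
def detClass (F : Type) [Field F] [Fintype F] : PGL(2, F) →* CTwo :=
  twoHom (Matrix.ProjectiveSpecialLinearGroup.toPGL (n := Fin 2) (R := F)).range
    fun _ _ => mul_mem_range_toPGL

theorem detClass_eq_one {τ : PGL(2, F)} : detClass F τ = 1 ↔
    τ ∈ (Matrix.ProjectiveSpecialLinearGroup.toPGL (n := Fin 2) (R := F)).range :=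
  twoHom_eq_one _

theorem detClass_galPGL (σ : RingAut F) (τ : PGL(2, F)) :
    detClass F (galPGL F σ τ) = detClass F τ := by
  by_cases h : detClass F τ = 1
  · rw [h, detClass_eq_one, galPGL_mem_range_toPGL_iff, ← detClass_eq_one, h]
  · refine CTwo.eq_of_ne_one ?_ h
    rwa [Ne, detClass_eq_one, galPGL_mem_range_toPGL_iff, ← detClass_eq_one]

theorem exists_notMem_range_toPGL (hQ : Fintype.card F % 4 = 1) :
    ∃ τ : PGL(2, F),
      τ ∉ (Matrix.ProjectiveSpecialLinearGroup.toPGL (n := Fin 2) (R := F)).range := by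
  have h2 : ringChar F ≠ 2 := fun h => by
    have := FiniteField.even_card_of_char_two h
    omega
  obtain ⟨a, ha⟩ := FiniteField.exists_nonsquare h2
  have ha0 : a ≠ 0 := fun h => ha (h ▸ IsSquare.zero)
  obtain ⟨g, hg⟩ := Matrix.GeneralLinearGroup.det_surjective (n := Fin 2) (Units.mk0 a ha0)
  refine ⟨Matrix.ProjGenLinGroup.mk g, fun h => ha ?_⟩
  rw [mk_mem_range_toPGL_iff] at h
  have : g.1.det = a := congrArg Units.val hg
  rwa [this] at h

end Projective

/-! ### The group `M` -/

section MGroupStructure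

variable {F : Type} [Field F] {α : RingAut F}

theorem zpowers_eq_or (hα : α * α = 1) (σ : Subgroup.zpowers α) :
    σ = 1 ∨ σ = ⟨α, Subgroup.mem_zpowers α⟩ := by
  obtain ⟨σ, i, rfl⟩ := σ
  have h2 : α ^ (2 : ℤ) = 1 := by rw [zpow_two, hα]
  rcases Int.even_or_odd' i with ⟨k, rfl | rfl⟩
  · exact Or.inl (Subtype.ext (by
      change α ^ (2 * k) = 1
      rw [zpow_mul, h2, one_zpow]))
  · exact Or.inr (Subtype.ext (by
      change α ^ (2 * k + 1) = α
      rw [zpow_add, zpow_mul, h2, one_zpow, one_mul, zpow_one]))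

/-- The isomorphism `⟨α⟩ ≅ ℤ/2`. -/
def galSign (hα : α * α = 1) : Subgroup.zpowers α →* CTwo :=
  twoHom ⊥ fun a b ha hb => by
    rw [Subgroup.mem_bot] at *
    rw [(zpowers_eq_or hα a).resolve_left ha, (zpowers_eq_or hα b).resolve_left hb]
    exact Subtype.ext hα

theorem galSign_eq_one (hα : α * α = 1) {σ : Subgroup.zpowers α} :
    galSign hα σ = 1 ↔ σ = 1 :=
  (twoHom_eq_one _).trans Subgroup.mem_bot

/-- The projection of `PGL(2, F) ⋊ ⟨α⟩` onto `ℤ/2`. -/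
def semiSign (hα : α * α = 1) : PGLSemi α →* CTwo :=
  (galSign hα).comp SemidirectProduct.rightHom

theorem semiSign_inl (hα : α * α = 1) (τ : PGL(2, F)) :
    semiSign hα (SemidirectProduct.inl τ) = 1 :=
  map_one (galSign hα)

theorem semiSign_galElt (hα : α * α = 1) (hα1 : α ≠ 1) : semiSign hα (galElt α) ≠ 1 :=
  fun h => hα1 (congrArg Subtype.val ((galSign_eq_one hα).1 h))

variable [Fintype F]

/-- The character of `PGL(2, F) ⋊ ⟨α⟩` with kernel `M`. -/
def semiChar (hα : α * α = 1) : PGLSemi α →* CTwo :=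
  SemidirectProduct.lift (detClass F) (galSign hα) fun σ => by
    refine MonoidHom.ext fun τ => ?_
    change detClass F (galPGL F σ τ) = galSign hα σ * detClass F τ * (galSign hα σ)⁻¹
    rw [detClass_galPGL, mul_comm, inv_mul_cancel_left]

theorem semiChar_inl (hα : α * α = 1) (τ : PGL(2, F)) :
    semiChar hα (SemidirectProduct.inl τ) = detClass F τ :=
  SemidirectProduct.lift_inl ..

theorem semiChar_inr (hα : α * α = 1) (σ : Subgroup.zpowers α) :
    semiChar hα (SemidirectProduct.inr σ) = galSign hα σ :=
  SemidirectProduct.lift_inr ..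

theorem semiChar_galElt_mul (hα : α * α = 1) (hα1 : α ≠ 1) {τ : PGL(2, F)}
    (hτ : τ ∉ (Matrix.ProjectiveSpecialLinearGroup.toPGL (n := Fin 2) (R := F)).range) :
    semiChar hα (galElt α * SemidirectProduct.inl τ) = 1 := by
  rw [map_mul, semiChar_inl, galElt, semiChar_inr]
  exact CTwo.mul_eq_one (semiSign_galElt hα hα1) (mt detClass_eq_one.1 hτ)

/-- Trivial `semiSign` leaves only the factor `PGL(2, F)`, where `semiChar` is the determinant
modulo squares. -/
theorem mem_pslSub_iff (hα : α * α = 1) {x : PGLSemi α} :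
    x ∈ pslSub α ↔ semiChar hα x = 1 ∧ semiSign hα x = 1 := by
  constructor
  · rintro ⟨y, rfl⟩
    refine ⟨?_, semiSign_inl hα _⟩
    exact (semiChar_inl hα _).trans (detClass_eq_one.2 ⟨y, rfl⟩)
  · rintro ⟨h1, h2⟩
    have hr : x.right = 1 := (galSign_eq_one hα).1 h2
    rw [← SemidirectProduct.inl_left_mul_inr_right x, hr, map_one, mul_one] at h1 ⊢
    rw [semiChar_inl, detClass_eq_one] at h1
    obtain ⟨y, hy⟩ := h1
    exact ⟨y, congrArg SemidirectProduct.inl hy⟩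

/-- An element of the kernel lies in `PSL(2, F)` if its `semiSign` is trivial. Otherwise it is `α`
times an element of `PGL(2, F)` whose determinant class must cancel that of `α`, hence is
non-trivial; this is one of the generators. -/
theorem MGroup_eq_ker (hα : α * α = 1) (hα1 : α ≠ 1) : MGroup α = (semiChar hα).ker := by
  apply le_antisymm
  · refine (Subgroup.closure_le _).2 ?_
    rintro x (hx | ⟨τ, hτ, rfl⟩)
    · exact ((mem_pslSub_iff hα).1 hx).1
    · exact semiChar_galElt_mul hα hα1 hτ
  · intro x hx
    rw [MonoidHom.mem_ker] at hx
    by_cases hs : semiSign hα x = 1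
    · exact Subgroup.subset_closure (Or.inl ((mem_pslSub_iff hα).2 ⟨hx, hs⟩))
    · obtain ⟨y, hy⟩ : ∃ y, y = (galElt α)⁻¹ * x := ⟨_, rfl⟩
      have hy1 : semiSign hα y = 1 := by
        rw [hy, map_mul, CTwo.eq_of_ne_one hs (semiSign_galElt hα hα1), map_inv, inv_mul_cancel]
      have hr : y.right = 1 := (galSign_eq_one hα).1 hy1
      have hyl : y = SemidirectProduct.inl y.left := by
        conv_lhs => rw [← SemidirectProduct.inl_left_mul_inr_right y, hr, map_one, mul_one]
      refine Subgroup.subset_closure (Or.inr ⟨y.left, fun h => ?_, ?_⟩)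
      · have h1 : semiChar hα y = 1 := by rw [hyl, semiChar_inl, detClass_eq_one]; exact h
        rw [hy, map_mul, hx, mul_one, map_inv, inv_eq_one] at h1
        rw [galElt, semiChar_inr] at h1
        exact semiSign_galElt hα hα1 h1
      · rw [← hyl, hy, mul_inv_cancel_left]

/-- Two elements of `M` outside `PSL(2, F)` agree under both characters, so they differ by an
element of `PSL(2, F)`. -/
theorem coe_MGroup (hα : α * α = 1) (hα1 : α ≠ 1) {τ : PGL(2, F)}
    (hτ : τ ∉ (Matrix.ProjectiveSpecialLinearGroup.toPGL (n := Fin 2) (R := F)).range) :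
    (MGroup α : Set (PGLSemi α)) = (pslSub α : Set (PGLSemi α)) ∪
      {y | ∃ x ∈ pslSub α, y = galElt α * SemidirectProduct.inl τ * x} := by
  have hm := semiChar_galElt_mul hα hα1 hτ
  have hs : semiSign hα (galElt α * SemidirectProduct.inl τ) ≠ 1 := by
    rw [map_mul, semiSign_inl, mul_one]
    exact semiSign_galElt hα hα1
  rw [MGroup_eq_ker hα hα1]
  ext y
  constructor
  · intro hy
    have hy' : semiChar hα y = 1 := hy
    by_cases h : semiSign hα y = 1
    · exact Or.inl ((mem_pslSub_iff hα).2 ⟨hy, h⟩)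
    · refine Or.inr ⟨(galElt α * SemidirectProduct.inl τ)⁻¹ * y, (mem_pslSub_iff hα).2 ⟨?_, ?_⟩,
        (mul_inv_cancel_left _ _).symm⟩
      · rw [map_mul, map_inv, hm, hy', inv_one, one_mul]
      · rw [map_mul, map_inv, CTwo.eq_of_ne_one h hs, inv_mul_cancel]
  · rintro (hy | ⟨x, hx, rfl⟩)
    · exact ((mem_pslSub_iff hα).1 hy).1
    · change semiChar hα _ = 1
      rw [map_mul, hm, ((mem_pslSub_iff hα).1 hx).1, one_mul]

theorem index_MGroup (hα : α * α = 1) (hα1 : α ≠ 1) : (MGroup α).index = 2 := by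
  rw [MGroup_eq_ker hα hα1, Subgroup.index_ker]
  have : (semiChar hα).range = ⊤ := by
    refine (Subgroup.eq_top_iff' _).2 fun a => ?_
    rcases CTwo.eq_one_or a with rfl | rfl
    · exact Subgroup.one_mem _
    · refine ⟨galElt α, CTwo.eq_of_ne_one ?_ (by decide)⟩
      rw [galElt, semiChar_inr]
      exact semiSign_galElt hα hα1
  rw [this, Subgroup.card_top]
  simp

instance : Finite (PGLSemi α) := by
  have : Finite (PGL(2, F)) := Finite.of_surjective _ Matrix.ProjGenLinGroup.mk_surjective
  have : Finite (RingAut F) := Finite.of_injective (fun σ : RingAut F => (σ : F → F))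
    DFunLike.coe_injective
  exact Finite.of_injective (fun x : PGLSemi α => (x.left, x.right)) fun _ _ h =>
    SemidirectProduct.ext (congrArg Prod.fst h) (congrArg Prod.snd h)

end MGroupStructure

/-! ### The action on `SL(2, F)` -/

section Action

variable {F : Type} [Field F]

theorem toPGL_eq_one_iff {y : SL(2, F)} :
    Matrix.SpecialLinearGroup.toPGL y = 1 ↔ y = 1 ∨ y = -1 := by
  rw [← MonoidHom.mem_ker, Matrix.SpecialLinearGroup.toPGL_ker,
    Matrix.SpecialLinearGroup.mem_center_iff]
  constructor
  · rintro ⟨r, hr, h⟩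
    rw [Fintype.card_fin, pow_two, mul_self_eq_one_iff] at hr
    rcases hr with rfl | rfl
    · exact Or.inl (Subtype.ext (by rw [← h]; simp))
    · exact Or.inr (Subtype.ext (by rw [← h, map_neg, map_one]; rfl))
  · rintro (rfl | rfl)
    · exact ⟨1, by simp, by simp⟩
    · exact ⟨-1, by simp, by rw [map_neg, map_one]; rfl⟩

theorem range_signSL (F : Type) [Field F] {y : SL(2, F)} :
    y ∈ (signSL F).range ↔ y = 1 ∨ y = -1 := by
  have h1 : signSL F (Multiplicative.ofAdd 1) = -1 := pow_one _
  constructor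
  · rintro ⟨a, rfl⟩
    rcases CTwo.eq_one_or a with rfl | rfl
    · exact Or.inl (map_one _)
    · exact Or.inr h1
  · rintro (rfl | rfl)
    · exact Subgroup.one_mem _
    · exact ⟨_, h1⟩

theorem signSL_ofAdd_one (F : Type) [Field F] : signSL F (Multiplicative.ofAdd 1) = -1 :=
  pow_one _

theorem neg_one_ne_one (h2 : (2 : F) ≠ 0) : (-1 : SL(2, F)) ≠ 1 := fun h => by
  have h1 := congrArg (fun x : SL(2, F) => (x : Matrix (Fin 2) (Fin 2) F) 0 0) h
  simp only [Matrix.SpecialLinearGroup.coe_neg, Matrix.SpecialLinearGroup.coe_one] at h1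
  simp only [Matrix.neg_apply, Matrix.one_apply_eq] at h1
  apply h2
  linear_combination -h1

theorem signSL_injective (h2 : (2 : F) ≠ 0) : Function.Injective (signSL F) := by
  rw [injective_iff_map_eq_one]
  intro a ha
  refine (CTwo.eq_one_or a).resolve_right fun h => neg_one_ne_one h2 ?_
  exact (signSL_ofAdd_one F).symm.trans (h ▸ ha)

variable {α : RingAut F}

/-- Equivariance of `SL(2, F) → PGL(2, F)`, which is the first crossed module axiom. Both sides are
compatible with products in `s`, so the two factors of the semidirect product suffice. -/
theorem inl_toPGL_semiAct (s : PGLSemi α) (y : SL(2, F)) :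
    (SemidirectProduct.inl (Matrix.SpecialLinearGroup.toPGL (semiAct α s y)) : PGLSemi α) =
      s * SemidirectProduct.inl (Matrix.SpecialLinearGroup.toPGL y) * s⁻¹ := by
  have h1 : ∀ (τ : PGL(2, F)) (y : SL(2, F)),
      (SemidirectProduct.inl (Matrix.SpecialLinearGroup.toPGL
        (semiAct α (SemidirectProduct.inl τ) y)) : PGLSemi α) =
        SemidirectProduct.inl τ * SemidirectProduct.inl (Matrix.SpecialLinearGroup.toPGL y) *
          (SemidirectProduct.inl τ)⁻¹ := by
    intro τ y
    induction τ using Matrix.ProjGenLinGroup.induction_on with | mk g =>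
    rw [semiAct, SemidirectProduct.lift_inl, ← map_inv, ← map_mul, ← map_mul]
    refine congrArg _ ?_
    change Matrix.ProjGenLinGroup.mk _ = Matrix.ProjGenLinGroup.mk (g * _ * g⁻¹)
    exact congrArg _ (Units.ext rfl)
  have h2 : ∀ (σ : Subgroup.zpowers α) (y : SL(2, F)),
      (SemidirectProduct.inl (Matrix.SpecialLinearGroup.toPGL
        (semiAct α (SemidirectProduct.inr σ) y)) : PGLSemi α) =
        SemidirectProduct.inr σ * SemidirectProduct.inl (Matrix.SpecialLinearGroup.toPGL y) *
          (SemidirectProduct.inr σ)⁻¹ := by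
    intro σ y
    rw [semiAct, SemidirectProduct.lift_inr, ← map_inv, ← SemidirectProduct.inl_aut]
    refine congrArg _ ?_
    change Matrix.ProjGenLinGroup.mk _ = Matrix.ProjGenLinGroup.mk (galGL F σ.1 _)
    exact congrArg _ (Units.ext rfl)
  rw [← SemidirectProduct.inl_left_mul_inr_right s, map_mul, MulAut.mul_apply, h1, h2]
  group

theorem semiAct_inl_toPGL (y y' : SL(2, F)) :
    semiAct α (SemidirectProduct.inl (Matrix.SpecialLinearGroup.toPGL y)) y' =
      y * y' * y⁻¹ := by
  rw [semiAct, SemidirectProduct.lift_inl]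
  refine Subtype.ext ?_
  change y.1 * y'.1 * (Matrix.SpecialLinearGroup.toGL y)⁻¹.1 = _
  rw [← map_inv]
  rfl

/-- By equivariance the action preserves the kernel `{1, -1}` of the map to `PGL(2, F)`;
automorphisms are injective. -/
theorem semiAct_neg_one (s : PGLSemi α) : semiAct α s (-1) = -1 := by
  have h : semiAct α s (-1) = 1 ∨ semiAct α s (-1) = -1 := by
    rw [← toPGL_eq_one_iff]
    apply SemidirectProduct.inl_injective (φ := (galPGL F).comp (Subgroup.zpowers α).subtype)
    rw [inl_toPGL_semiAct, toPGL_eq_one_iff.2 (Or.inr rfl)]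
    simp
  rcases h with h | h
  · rw [h]
    exact ((MulEquiv.map_eq_one_iff _).1 h).symm
  · exact h

/-- If the square of an element of `M` outside `PSL(2, F)` lifts to `Φ`, then the element maps
`Φ` to `-Φ`. -/
theorem semiAct_eq_neg [Fintype F] {q : ℕ} (hodd : Odd q) (hF : Fintype.card F = q ^ 2)
    (hαq : ∀ x : F, α x = x ^ q) (hα : α * α = 1) {s : PGLSemi α}
    (h1 : semiChar hα s = 1) (hs : semiSign hα s ≠ 1) {Φ : SL(2, F)}
    (hΦ : s * s = SemidirectProduct.inl (Matrix.SpecialLinearGroup.toPGL Φ)) :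
    semiAct α s Φ = -Φ := by
  have hr : s.right = ⟨α, Subgroup.mem_zpowers α⟩ :=
    (zpowers_eq_or hα _).resolve_left (mt (galSign_eq_one hα).2 hs)
  obtain ⟨t, ht⟩ := Matrix.ProjGenLinGroup.mk_surjective s.left
  have hs' : s = SemidirectProduct.inl (Matrix.ProjGenLinGroup.mk t) *
      SemidirectProduct.inr ⟨α, Subgroup.mem_zpowers α⟩ := by
    conv_lhs => rw [← SemidirectProduct.inl_left_mul_inr_right s, hr, ← ht]
  have hd : ¬IsSquare t.1.det := by
    rw [← mk_mem_range_toPGL_iff, ← detClass_eq_one, ht]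
    intro h
    apply hs
    rw [← SemidirectProduct.inl_left_mul_inr_right s, map_mul, semiChar_inl, h, one_mul,
      semiChar_inr] at h1
    exact h1
  have hd0 : t.1.det ≠ 0 := fun h => hd (h ▸ IsSquare.zero)
  have h2 : ringChar F ≠ 2 := fun h => hd (FiniteField.isSquare_of_char_two h _)
  -- For `s = tα` the square is the class of `t α(t)`, so this matrix is a scalar multiple of `Φ`.
  obtain ⟨u, hu⟩ : ∃ u : Fˣ, Matrix.SpecialLinearGroup.toGL Φ *
      Matrix.GeneralLinearGroup.scalar (Fin 2) u = t * galGL F α t := by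
    refine Matrix.ProjGenLinGroup.mk_eq_mk_iff.1 (Eq.symm ?_)
    have := congrArg SemidirectProduct.left hΦ
    rw [SemidirectProduct.mul_left, ← ht, hr] at this
    exact this
  let m : Matrix (Fin 2) (Fin 2) F ≃+* Matrix (Fin 2) (Fin 2) F := RingEquiv.mapMatrix α
  have hu' : Φ.1 * Matrix.scalar (Fin 2) (u : F) = t.1 * m t.1 := congrArg Units.val hu
  have hαα : ∀ x, α (α x) = x := fun x => DFunLike.congr_fun hα x
  have hmm : m (m t.1) = t.1 := by
    ext i j
    exact hαα _
  have hms : m (Matrix.scalar (Fin 2) (u : F)) = Matrix.scalar (Fin 2) (α (u : F)) := by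
    ext i j
    change α (Matrix.scalar (Fin 2) (u : F) i j) = _
    simp only [Matrix.scalar_apply, Matrix.diagonal_apply]
    split_ifs <;> simp
  have hdet : (u : F) * u = t.1.det ^ (q + 1) := by
    have h := congrArg Matrix.det hu'
    rw [Matrix.det_mul, Matrix.det_mul, Φ.2, one_mul] at h
    have h' : (m t.1).det = α t.1.det := (RingEquiv.map_det α t.1).symm
    rw [h', hαq] at h
    rw [pow_succ', ← h]
    simp [pow_two]
  -- For `q = 2k + 1` one has `(q² - 1)/2 = (q + 1)k`. Hence Euler's criterion for the non-square
  -- `det t` reads `(u²)^k = -1`, that is, `u^(q-1) = -1`.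
  have hαu : α (u : F) = -u := by
    obtain ⟨k, rfl⟩ := hodd
    have hk : Fintype.card F / 2 = (2 * k + 1 + 1) * k := by
      rw [hF, show (2 * k + 1) ^ 2 = 2 * ((2 * k + 1 + 1) * k) + 1 by ring]
      omega
    have h := (FiniteField.pow_dichotomy h2 hd0).resolve_left
      (mt (FiniteField.isSquare_iff h2 hd0).2 hd)
    rw [hk, pow_mul, ← hdet, mul_pow, ← pow_add] at h
    rw [hαq, pow_succ, two_mul, h, neg_one_mul]
  refine Subtype.ext ?_
  have hact : (semiAct α s Φ).1 = t.1 * m Φ.1 * t⁻¹.1 := by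
    rw [hs', map_mul, MulAut.mul_apply, semiAct, SemidirectProduct.lift_inl,
      SemidirectProduct.lift_inr]
    rfl
  -- Applying `α` to `uΦ = t α(t)` gives `α(u) α(Φ) = α(t) t`; conjugating by `t` brings back `t
  -- α(t) = uΦ`.
  have hm : m Φ.1 * Matrix.scalar (Fin 2) (α (u : F)) = m t.1 * t.1 := by
    rw [← hms, ← map_mul, hu', map_mul, hmm]
  have hcomm : ∀ (r : F) (A : Matrix (Fin 2) (Fin 2) F),
      A * Matrix.scalar (Fin 2) r = r • A := by
    intro r A
    ext i j
    simp [Matrix.mul_apply, Matrix.diagonal_apply, mul_comm]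
  rw [hcomm] at hm hu'
  rw [hαu] at hm
  have hfin : (-(u : F)) • (t.1 * m Φ.1 * t⁻¹.1) = (u : F) • Φ.1 := by
    rw [hu', ← Matrix.smul_mul, ← Matrix.mul_smul, hm, ← mul_assoc, mul_assoc (t.1 * m t.1)]
    rw [← Units.val_mul, mul_inv_cancel, Units.val_one, mul_one]
  rw [hact]
  have hu0 : (u : F) ≠ 0 := u.ne_zero
  have := congrArg (fun A => (u : F)⁻¹ • A) hfin
  simp only [smul_smul, smul_neg, inv_mul_cancel₀ hu0, neg_smul, one_smul] at this
  exact neg_eq_iff_eq_neg.1 this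

end Action

/-! ### The crossed module `SL(2, F) → M` -/

section Crossed

variable {F : Type} [Field F] {α : RingAut F}

/-- The surjection `M → ℤ/2` with kernel `PSL(2, F)`. -/
def mSign (hα : α * α = 1) : MGroup α →* CTwo := (semiSign hα).comp (MGroup α).subtype

theorem inl_toPGL_mem (y : SL(2, F)) :
    (SemidirectProduct.inl (Matrix.SpecialLinearGroup.toPGL y) : PGLSemi α) ∈ pslSub α :=
  ⟨QuotientGroup.mk y, rfl⟩

theorem semiAct_signSL (s : PGLSemi α) (a : CTwo) : semiAct α s (signSL F a) = signSL F a := by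
  rcases (range_signSL F).1 ⟨a, rfl⟩ with h | h <;> rw [h]
  · exact map_one _
  · exact semiAct_neg_one s

/-- The projection of `SL(2, F)` onto the kernel of `M → ℤ/2`. -/
def slProj (hα : α * α = 1) : SL(2, F) →* (mSign hα).ker where
  toFun y := ⟨⟨SemidirectProduct.inl (Matrix.SpecialLinearGroup.toPGL y),
    Subgroup.subset_closure (Or.inl (inl_toPGL_mem y))⟩, semiSign_inl hα _⟩
  map_one' := Subtype.ext (Subtype.ext (by simp))
  map_mul' x y := Subtype.ext (Subtype.ext (by simp))

theorem coe_slProj (hα : α * α = 1) (y : SL(2, F)) : ((slProj hα y : MGroup α) : PGLSemi α) =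
    SemidirectProduct.inl (Matrix.SpecialLinearGroup.toPGL y) := rfl

theorem slProj_eq_one_iff (hα : α * α = 1) {y : SL(2, F)} :
    slProj hα y = 1 ↔ y = 1 ∨ y = -1 := by
  rw [← toPGL_eq_one_iff]
  constructor
  · intro h
    have := congrArg (fun x : (mSign hα).ker => ((x : MGroup α) : PGLSemi α)) h
    exact SemidirectProduct.inl_injective (this.trans (map_one _).symm)
  · intro h
    exact Subtype.ext (Subtype.ext (by rw [coe_slProj, h, map_one]; rfl))

theorem isCrossedModule_slProj (hα : α * α = 1) :
    IsCrossedModule ((mSign hα).ker.subtype.comp (slProj hα))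
      ((semiAct α).comp (MGroup α).subtype) where
  map_act g c := Subtype.ext (inl_toPGL_semiAct g.1 c)
  peiffer c c' := semiAct_inl_toPGL c c'

variable [Fintype F]

theorem ker_mSign (hα : α * α = 1) (hα1 : α ≠ 1) :
    (mSign hα).ker = (pslSub α).subgroupOf (MGroup α) := by
  ext ⟨x, hx⟩
  rw [MonoidHom.mem_ker, Subgroup.mem_subgroupOf, mem_pslSub_iff hα]
  have hx' : semiChar hα x = 1 := by rw [MGroup_eq_ker hα hα1] at hx; exact hx
  exact ⟨fun h => ⟨hx', h⟩, fun h => h.2⟩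

theorem mSign_surjective (hQ : Fintype.card F % 4 = 1) (hα : α * α = 1) (hα1 : α ≠ 1) :
    Function.Surjective (mSign hα) := by
  intro a
  rcases CTwo.eq_one_or a with rfl | rfl
  · exact ⟨1, map_one _⟩
  · obtain ⟨τ, hτ⟩ := exists_notMem_range_toPGL hQ
    refine ⟨⟨galElt α * SemidirectProduct.inl τ, ?_⟩, CTwo.eq_of_ne_one ?_ (by decide)⟩
    · rw [MGroup_eq_ker hα hα1]
      exact semiChar_galElt_mul hα hα1 hτ
    · change semiSign hα (galElt α * SemidirectProduct.inl τ) ≠ 1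
      rw [map_mul, semiSign_inl, mul_one]
      exact semiSign_galElt hα hα1

theorem slProj_surjective (hα : α * α = 1) (hα1 : α ≠ 1) :
    Function.Surjective (slProj hα) := by
  rintro ⟨⟨x, hx⟩, hk⟩
  have h : (⟨x, hx⟩ : MGroup α) ∈ (pslSub α).subgroupOf (MGroup α) := ker_mSign hα hα1 ▸ hk
  obtain ⟨y, hy⟩ := Subgroup.mem_subgroupOf.1 h
  obtain ⟨y, rfl⟩ := QuotientGroup.mk_surjective y
  exact ⟨y, Subtype.ext (Subtype.ext hy)⟩

theorem isSchurDoubleCover_slProj (hQ : Fintype.card F % 4 = 1) (hα : α * α = 1)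
    (hα1 : α ≠ 1) : IsSchurDoubleCover (signSL F) (slProj hα) where
  surjective := slProj_surjective hα hα1
  injective := signSL_injective (by
    refine Ring.two_ne_zero fun h => ?_
    have := FiniteField.even_card_of_char_two h
    omega)
  exact := by
    ext y
    rw [range_signSL, MonoidHom.mem_ker, slProj_eq_one_iff]
  central a y := by
    rcases (range_signSL F).1 ⟨a, rfl⟩ with h | h <;> rw [h] <;> simp
  perfect := SLTwo.commutator_eq_top hQ
  coboundary _ hc := SLTwo.exists_coboundary hQ hc
  pair := by
    -- The torus element of a square root `i` of `-1` anticommutes with the Weyl element, since `i⁻¹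
    -- = -i`.
    obtain ⟨i, hi⟩ := (FiniteField.isSquare_neg_one_iff (F := F)).2 (by omega)
    have hi0 : i ≠ 0 := by
      rintro rfl
      simp at hi
    refine ⟨SLTwo.torus F (Units.mk0 i hi0), SLTwo.weyl F, ?_⟩
    have hinv : (Units.mk0 i hi0)⁻¹ = -1 * Units.mk0 i hi0 := by
      rw [inv_eq_iff_mul_eq_one]
      refine Units.ext ?_
      simp [← hi]
    rw [SLTwo.weyl_mul_torus, hinv, map_mul, SLTwo.torus_neg_one, signSL_ofAdd_one]
    simp

end Crossed

/-! ### Cohomology of the group of order two with coefficients in `ℤ/2` -/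

namespace groupCohomology

variable {G : Type} [Group G] (A : Rep.{0} ℤ G) (n : ℕ)

theorem d_iCocycles (c : cocycles A n) :
    (inhomogeneousCochains.d A n).hom (iCocycles A n c) = 0 := by
  have h := (inhomogeneousCochains A).iCycles_d n (n + 1)
  have h' := congrArg (fun t => t.hom c) h
  rw [inhomogeneousCochains.d_def] at h'
  exact h'

theorem iCocycles_injective : Function.Injective (iCocycles A n) :=
  (ModuleCat.mono_iff_injective _).1 inferInstance

/-- Cohomology is the cokernel of the map from cochains to cocycles, so a vanishing class lifts to a
cochain. -/
theorem π_eq_zero_iff (c : cocycles A (n + 1)) :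
    π A (n + 1) c = 0 ↔ ∃ b : (Fin n → G) → A,
      (inhomogeneousCochains.d A n).hom b = iCocycles A (n + 1) c := by
  have hi : ∀ b, iCocycles A (n + 1) (toCocycles A n (n + 1) b) =
      (inhomogeneousCochains.d A n).hom b := by
    intro b
    have h := congrArg (fun t => t.hom b) ((inhomogeneousCochains A).toCycles_i n (n + 1))
    rw [inhomogeneousCochains.d_def] at h
    exact h
  constructor
  · intro h
    have hex := ShortComplex.exact_of_g_is_cokernel (ShortComplex.mk _ _
      ((inhomogeneousCochains A).toCycles_comp_homologyπ n (n + 1)))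
      ((inhomogeneousCochains A).homologyIsCokernel n (n + 1) (by simp))
    obtain ⟨b, hb⟩ := (ShortComplex.moduleCat_exact_iff _).1 hex c h
    exact ⟨b, (hi b).symm.trans (congrArg _ hb)⟩
  · rintro ⟨b, hb⟩
    have hc : c = toCocycles A n (n + 1) b := iCocycles_injective A _ (hb.symm.trans (hi b).symm)
    rw [hc]
    exact congrArg (fun t => t.hom b)
      ((inhomogeneousCochains A).toCycles_comp_homologyπ n (n + 1))

end groupCohomology

namespace CTwoCohomology

/-- The generator of the cyclic group of order two. -/
abbrev gen : CTwo := Multiplicative.ofAdd 1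

/-- The trivial module `ℤ/2` of the group of order two. -/
abbrev Triv : Rep.{0} ℤ CTwo := Rep.trivial ℤ CTwo (ZMod 2)

/-- Modulo two all signs of the differential disappear; written on explicit vectors, cochain
identities become finite checks. -/
theorem d_one_apply (b : (Fin 1 → CTwo) → ZMod 2) (x y : CTwo) :
    ((inhomogeneousCochains.d Triv 1).hom b : (Fin 2 → CTwo) → ZMod 2) ![x, y] =
      b ![y] + b ![x * y] + b ![x] := by
  have h0 : (fun i : Fin 1 => (![x, y] : Fin 2 → CTwo) i.succ) = ![y] := by
    funext i; fin_cases i; rfl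
  have h1 : Fin.contractNth (0 : Fin 2) (· * ·) ![x, y] = ![x * y] := by
    funext i; fin_cases i; rfl
  have h2 : Fin.contractNth (1 : Fin 2) (· * ·) ![x, y] = ![x] := by
    funext i; fin_cases i; rfl
  rw [inhomogeneousCochains.d_hom_apply]
  change b _ + _ = _
  rw [Fin.sum_univ_two, h0, h1, h2]
  change b ![y] + ((-1 : ℤ) ^ 1 • b ![x * y] + (-1 : ℤ) ^ 2 • b ![x]) = _
  norm_num
  ring

theorem d_two_apply (b : (Fin 2 → CTwo) → ZMod 2) (x y w : CTwo) :
    ((inhomogeneousCochains.d Triv 2).hom b : (Fin 3 → CTwo) → ZMod 2)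
      ![x, y, w] = b ![y, w] + b ![x * y, w] + b ![x, y * w] + b ![x, y] := by
  have h0 : (fun i : Fin 2 => (![x, y, w] : Fin 3 → CTwo) i.succ) = ![y, w] := by
    funext i; fin_cases i <;> rfl
  have h1 : Fin.contractNth (0 : Fin 3) (· * ·) ![x, y, w] = ![x * y, w] := by
    funext i; fin_cases i <;> rfl
  have h2 : Fin.contractNth (1 : Fin 3) (· * ·) ![x, y, w] = ![x, y * w] := by
    funext i; fin_cases i <;> rfl
  have h3 : Fin.contractNth (2 : Fin 3) (· * ·) ![x, y, w] = ![x, y] := by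
    funext i; fin_cases i <;> rfl
  rw [inhomogeneousCochains.d_hom_apply]
  change b _ + _ = _
  rw [Fin.sum_univ_three, h0, h1, h2, h3]
  change b ![y, w] + ((-1 : ℤ) ^ 1 • b ![x * y, w] + (-1 : ℤ) ^ 2 • b ![x, y * w] +
    (-1 : ℤ) ^ 3 • b ![x, y]) = _
  norm_num
  ring

theorem d_three_apply (b : (Fin 3 → CTwo) → ZMod 2) (x y w v : CTwo) :
    ((inhomogeneousCochains.d Triv 3).hom b : (Fin 4 → CTwo) → ZMod 2)
      ![x, y, w, v] = b ![y, w, v] + b ![x * y, w, v] + b ![x, y * w, v] + b ![x, y, w * v]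
        + b ![x, y, w] := by
  have h0 : (fun i : Fin 3 => (![x, y, w, v] : Fin 4 → CTwo) i.succ) = ![y, w, v] := by
    funext i; fin_cases i <;> rfl
  have h1 : Fin.contractNth (0 : Fin 4) (· * ·) ![x, y, w, v] = ![x * y, w, v] := by
    funext i; fin_cases i <;> rfl
  have h2 : Fin.contractNth (1 : Fin 4) (· * ·) ![x, y, w, v] = ![x, y * w, v] := by
    funext i; fin_cases i <;> rfl
  have h3 : Fin.contractNth (2 : Fin 4) (· * ·) ![x, y, w, v] = ![x, y, w * v] := by
    funext i; fin_cases i <;> rfl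
  have h4 : Fin.contractNth (3 : Fin 4) (· * ·) ![x, y, w, v] = ![x, y, w] := by
    funext i; fin_cases i <;> rfl
  rw [inhomogeneousCochains.d_hom_apply]
  change b _ + _ = _
  rw [Fin.sum_univ_four, h0, h1, h2, h3, h4]
  change b ![y, w, v] + ((-1 : ℤ) ^ 1 • b ![x * y, w, v] + (-1 : ℤ) ^ 2 • b ![x, y * w, v] +
    (-1 : ℤ) ^ 3 • b ![x, y, w * v] + (-1 : ℤ) ^ 4 • b ![x, y, w]) = _
  norm_num
  ring

/-- The pairing of a `3`-cochain with the generator of `H₃(ℤ/2, ℤ/2)`. -/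
def invariant (c : (Fin 3 → CTwo) → ZMod 2) : ZMod 2 :=
  -- The two degenerate terms are needed for the functional to vanish on coboundaries of cochains
  -- that are not normalized.
  c ![gen, gen, gen] + c ![1, 1, gen] + c ![gen, 1, 1]

theorem vec_one (g : Fin 1 → CTwo) : g = ![g 0] := by funext i; fin_cases i; rfl

theorem vec_two (g : Fin 2 → CTwo) : g = ![g 0, g 1] := by funext i; fin_cases i <;> rfl

theorem vec_three (g : Fin 3 → CTwo) : g = ![g 0, g 1, g 2] := by
  funext i; fin_cases i <;> rfl

theorem vec_four (g : Fin 4 → CTwo) : g = ![g 0, g 1, g 2, g 3] := by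
  funext i; fin_cases i <;> rfl

theorem gen_mul_gen : gen * gen = 1 := rfl

theorem invariant_d (b : (Fin 2 → CTwo) → ZMod 2) :
    invariant ((inhomogeneousCochains.d Triv 2).hom b) = 0 := by
  unfold invariant
  rw [d_two_apply, d_two_apply, d_two_apply]
  simp only [gen_mul_gen, one_mul, mul_one]
  generalize b ![1, 1] = b1, b ![1, gen] = b2, b ![gen, 1] = b3, b ![gen, gen] = b4
  revert b1 b2 b3 b4
  decide

/-- The class of a `3`-cocycle is determined by its invariant. -/
theorem π_eq_zero_of_invariant (c : groupCohomology.cocycles Triv 3)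
    (hc : invariant (groupCohomology.iCocycles Triv 3 c) = 0) :
    groupCohomology.π Triv 3 c = 0 := by
  refine (groupCohomology.π_eq_zero_iff Triv 2 c).2 ?_
  obtain ⟨f, hf⟩ : ∃ f : (Fin 3 → CTwo) → ZMod 2, f = groupCohomology.iCocycles Triv 3 c :=
    ⟨_, rfl⟩
  have hd : ∀ x y w v, f ![y, w, v] + f ![x * y, w, v] + f ![x, y * w, v] + f ![x, y, w * v]
        + f ![x, y, w] = 0 := by
    intro x y w v
    rw [← d_three_apply, hf]
    exact congrFun (groupCohomology.d_iCocycles Triv 3 c) _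
  rw [← hf] at hc ⊢
  -- These five cocycle relations, with the vanishing of the invariant, express all eight values of
  -- `f` by those at `![1, 1, gen]` and `![gen, 1, 1]`.
  have e1 := hd 1 1 1 1
  have e2 := hd 1 1 gen 1
  have e3 := hd 1 1 gen gen
  have e4 := hd gen gen 1 1
  have e5 := hd gen 1 1 gen
  unfold invariant at hc
  simp only [gen_mul_gen, one_mul, mul_one] at e1 e2 e3 e4 e5
  have h1 : f ![1, 1, 1] = 0 := by
    generalize f ![1, 1, 1] = a1 at *
    clear * - e1; revert a1; decide
  rw [h1] at e3 e4
  have h2 : f ![1, gen, 1] = 0 := by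
    generalize f ![1, gen, 1] = a1, f ![1, 1, gen] = a2 at *
    clear * - e2; revert a1 a2; decide
  have h3 : f ![1, gen, gen] = f ![1, 1, gen] := by
    generalize f ![1, gen, gen] = a1, f ![1, 1, gen] = a2 at *
    clear * - e3; revert a1 a2; decide
  have h4 : f ![gen, gen, 1] = f ![gen, 1, 1] := by
    generalize f ![gen, gen, 1] = a1, f ![gen, 1, 1] = a2 at *
    clear * - e4; revert a1 a2; decide
  have h5 : f ![gen, 1, gen] = f ![1, 1, gen] + f ![gen, 1, 1] := by
    generalize f ![gen, 1, gen] = a1, f ![gen, 1, 1] = a2, f ![1, 1, gen] = a3 at *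
    clear * - e5; revert a1 a2 a3; decide
  have h6 : f ![gen, gen, gen] = f ![1, 1, gen] + f ![gen, 1, 1] := by
    generalize f ![gen, gen, gen] = a1, f ![gen, 1, 1] = a2, f ![1, 1, gen] = a3 at *
    clear * - hc; revert a1 a2 a3; decide
  obtain ⟨a, h7⟩ : ∃ a, f ![1, 1, gen] = a := ⟨_, rfl⟩
  obtain ⟨a', h8⟩ : ∃ a', f ![gen, 1, 1] = a' := ⟨_, rfl⟩
  -- The coboundary of `b` has the value `b ![1, gen]` at `![1, 1, gen]` and `b ![gen, 1]` at
  -- `![gen, 1, 1]`, which forces this choice.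
  let b : (Fin 2 → CTwo) → ZMod 2 := fun g =>
    if g 0 = 1 then (if g 1 = 1 then 0 else a) else (if g 1 = 1 then a' else 0)
  have b1 : b ![1, 1] = 0 := rfl
  have b2 : b ![1, gen] = a := rfl
  have b3 : b ![gen, 1] = a' := rfl
  have b4 : b ![gen, gen] = 0 := rfl
  refine ⟨b, funext fun g => ?_⟩
  rw [vec_three g]
  refine (d_two_apply b _ _ _).trans ?_
  generalize g 0 = x, g 1 = y, g 2 = w
  have key : ∀ x y w, b ![y, w] + b ![x * y, w] + b ![x, y * w] + b ![x, y] = f ![x, y, w] := by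
    intro x y w
    rcases CTwo.eq_one_or x with rfl | rfl <;> rcases CTwo.eq_one_or y with rfl | rfl <;>
      rcases CTwo.eq_one_or w with rfl | rfl <;>
      simp only [gen_mul_gen, one_mul, mul_one, b1, b2, b3, b4, h1, h2, h3, h4, h5, h6, h7, h8,
        zero_add, add_zero, CharTwo.add_self_eq_zero]
  exact key x y w

theorem π_eq_of_invariant {c c' : groupCohomology.cocycles Triv 3}
    (h : invariant (groupCohomology.iCocycles Triv 3 c) =
      invariant (groupCohomology.iCocycles Triv 3 c')) :
    groupCohomology.π Triv 3 c = groupCohomology.π Triv 3 c' := by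
  rw [← sub_eq_zero, ← map_sub]
  apply π_eq_zero_of_invariant
  rw [map_sub]
  unfold invariant at *
  change (_ - _) + (_ - _) + (_ - _) = (0 : ZMod 2)
  linear_combination h

theorem π_ne_zero_of_invariant {c : groupCohomology.cocycles Triv 3}
    (h : invariant (groupCohomology.iCocycles Triv 3 c) = 1) :
    groupCohomology.π Triv 3 c ≠ 0 := fun h0 => by
  obtain ⟨b, hb⟩ := (groupCohomology.π_eq_zero_iff Triv 2 c).1 h0
  rw [← hb] at h
  exact zero_ne_one ((invariant_d b).symm.trans h)

/-- The identity of `ℤ/2` as a `1`-cocycle. -/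
def oneCocycle : groupCohomology.cocycles Triv 1 :=
  groupCohomology.cocyclesMk (A := Triv) (fun g : Fin 1 → CTwo => Multiplicative.toAdd (g 0)) (by
    funext g
    rw [vec_two g]
    refine (d_one_apply _ _ _).trans ?_
    generalize g 0 = x, g 1 = y
    revert x y; decide)

/-- The cup square of the identity of `ℤ/2`. -/
def squareCocycle : groupCohomology.cocycles Triv 2 :=
  groupCohomology.cocyclesMk (A := Triv) (fun g : Fin 2 → CTwo =>
    Multiplicative.toAdd (g 0) * Multiplicative.toAdd (g 1)) (by
    funext g
    rw [vec_three g]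
    refine (d_two_apply _ _ _ _).trans ?_
    generalize g 0 = x, g 1 = y, g 2 = w
    revert x y w; decide)

/-- The cup cube of the identity of `ℤ/2`. -/
def cubeCocycle : groupCohomology.cocycles Triv 3 :=
  groupCohomology.cocyclesMk (A := Triv) (fun g : Fin 3 → CTwo =>
    Multiplicative.toAdd (g 0) * Multiplicative.toAdd (g 1) * Multiplicative.toAdd (g 2)) (by
    funext g
    rw [vec_four g]
    refine (d_three_apply _ _ _ _ _).trans ?_
    generalize g 0 = x, g 1 = y, g 2 = w, g 3 = v
    revert x y w v; decide)

theorem iCocycles_oneCocycle : groupCohomology.iCocycles Triv 1 oneCocycle =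
    fun g : Fin 1 → CTwo => Multiplicative.toAdd (g 0) := by
  rw [oneCocycle, groupCohomology.iCocycles_mk]

theorem iCocycles_squareCocycle : groupCohomology.iCocycles Triv 2 squareCocycle =
    fun g : Fin 2 → CTwo => Multiplicative.toAdd (g 0) * Multiplicative.toAdd (g 1) := by
  rw [squareCocycle, groupCohomology.iCocycles_mk]

theorem iCocycles_cubeCocycle : groupCohomology.iCocycles Triv 3 cubeCocycle =
    fun g : Fin 3 → CTwo =>
      Multiplicative.toAdd (g 0) * Multiplicative.toAdd (g 1) * Multiplicative.toAdd (g 2) := by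
  rw [cubeCocycle, groupCohomology.iCocycles_mk]

theorem invariant_cubeCocycle :
    invariant (groupCohomology.iCocycles Triv 3 cubeCocycle) = 1 := by
  rw [iCocycles_cubeCocycle]
  decide

theorem isCube : IsCube (G := CTwo) (R := ZMod 2) (groupCohomology.π Triv 1 oneCocycle)
    (groupCohomology.π Triv 3 cubeCocycle) := by
  refine ⟨groupCohomology.π Triv 2 squareCocycle,
    ⟨oneCocycle, oneCocycle, squareCocycle, rfl, rfl, rfl, fun g => ?_⟩,
    ⟨squareCocycle, oneCocycle, cubeCocycle, rfl, rfl, rfl, fun g => ?_⟩⟩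
  · refine (congrFun iCocycles_squareCocycle g).trans ?_
    exact congrArg₂ (· * ·)
      (congrFun iCocycles_oneCocycle fun i => g (Fin.castAdd 1 i)).symm
      (congrFun iCocycles_oneCocycle fun i => g (Fin.natAdd 1 i)).symm
  · refine (congrFun iCocycles_cubeCocycle g).trans ?_
    exact congrArg₂ (· * ·)
      (congrFun iCocycles_squareCocycle fun i => g (Fin.castAdd 1 i)).symm
      (congrFun iCocycles_oneCocycle fun i => g (Fin.natAdd 2 i)).symm

/-- With trivial action the coboundary of a `0`-cochain is zero. -/
theorem π_oneCocycle_ne_zero : groupCohomology.π Triv 1 oneCocycle ≠ 0 := fun h => by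
  obtain ⟨b, hb⟩ := (groupCohomology.π_eq_zero_iff Triv 0 oneCocycle).1 h
  rw [iCocycles_oneCocycle] at hb
  have h1 := congrFun hb ![gen]
  rw [inhomogeneousCochains.d_hom_apply, Fin.sum_univ_one] at h1
  have h2 : b (fun i : Fin 0 => (![gen] : Fin 1 → CTwo) i.succ) +
      (-1 : ℤ) ^ 1 • b (Fin.contractNth (0 : Fin 1) (· * ·) ![gen]) = (1 : ZMod 2) := h1
  rw [Subsingleton.elim (Fin.contractNth (0 : Fin 1) (· * ·) ![gen])
    (fun i : Fin 0 => (![gen] : Fin 1 → CTwo) i.succ), pow_one, neg_smul, one_smul] at h2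
  exact zero_ne_one ((add_neg_cancel _).symm.trans h2)

/-- A `1`-cocycle vanishes at the identity, so its value at the generator determines it. -/
theorem eq_π_oneCocycle {v : groupCohomology Triv 1} (hv : v ≠ 0) :
    v = groupCohomology.π Triv 1 oneCocycle := by
  induction v using groupCohomology_induction_on with
  | h c =>
  obtain ⟨f, hf⟩ : ∃ f : (Fin 1 → CTwo) → ZMod 2, f = groupCohomology.iCocycles Triv 1 c :=
    ⟨_, rfl⟩
  have h1 : f ![1] = 0 := by
    have h : f ![1] + f ![1 * 1] + f ![1] = 0 := by
      rw [← d_one_apply, hf]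
      exact congrFun (groupCohomology.d_iCocycles Triv 1 c) _
    rw [mul_one] at h
    generalize f ![1] = a at h ⊢
    revert a; decide
  have h2 : ∀ a : ZMod 2, a = 0 ∨ a = 1 := by decide
  rcases h2 (f ![gen]) with h | h
  · refine absurd ?_ hv
    have hc : c = 0 := by
      apply groupCohomology.iCocycles_injective
      rw [map_zero, ← hf]
      funext g
      rw [vec_one g]
      rcases CTwo.eq_one_or (g 0) with h' | h' <;> rw [h']
      · exact h1
      · exact h
    rw [hc, map_zero]
  · refine congrArg _ (groupCohomology.iCocycles_injective Triv 1 ?_)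
    rw [iCocycles_oneCocycle, ← hf]
    funext g
    rw [vec_one g]
    rcases CTwo.eq_one_or (g 0) with h' | h' <;> rw [h']
    · exact h1
    · exact h

/-- The invariant of the cocycle of a crossed module over `ℤ/2`, when a lift of the square of an
element over the generator is mapped by it to its negative. -/
theorem invariant_of_crossed {C G : Type} [Group C] [Group G] {d : C →* G} {act : G →* MulAut C}
    (hd : IsCrossedModule d act) {ι : CTwo →* C} (hι : Function.Injective ι)
    (hcen : ∀ a x, x * ι a = ι a * x)
    {s : CTwo → G} {F : CTwo → CTwo → C} {c : (Fin 3 → CTwo) → ZMod 2}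
    (hs : ∀ x y, s x * s y = d (F x y) * s (x * y))
    (hF : ∀ x y w, act (s x) (F y w) * F x (y * w) =
      ι (Multiplicative.ofAdd (c ![x, y, w])) * F x y * F (x * y) w)
    (hneg : ∀ Φ, s gen * s gen = d Φ → act (s gen) Φ = ι gen * Φ) :
    invariant c = 1 := by
  have e1 := hF 1 1 gen
  have e2 := hF gen 1 1
  have e3 := hF gen gen gen
  -- The section need not be normalized, so the lift of the square of `s gen` is `F gen gen * F 1
  -- 1`. The relations at `(1, 1, gen)`, through the Peiffer identity, and at `(gen, 1, 1)` account
  -- for the degenerate terms of the invariant.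
  have s1 : s 1 = d (F 1 1) := mul_right_cancel (hs 1 1)
  have s2 := hs gen gen
  simp only [gen_mul_gen, one_mul, mul_one] at e1 e2 e3 s2
  rw [s1, ← map_mul] at s2
  have n := hneg _ s2
  rw [map_mul] at n
  have e1' := mul_right_cancel e1
  have e2' := mul_right_cancel e2
  rw [s1, hd.peiffer, mul_inv_eq_iff_eq_mul, ← hcen, mul_assoc] at e1'
  have e1'' := mul_left_cancel e1'
  rw [e2', ← mul_assoc, hcen, mul_assoc, e3, e1'', mul_assoc, ← mul_assoc (F gen gen), hcen,
    mul_assoc, ← mul_assoc, ← mul_assoc, ← map_mul, ← map_mul] at n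
  have h : c ![gen, 1, 1] + c ![gen, gen, gen] + c ![1, 1, gen] = 1 :=
    Multiplicative.ofAdd.injective (hι (mul_right_cancel n))
  unfold invariant
  linear_combination h

end CTwoCohomology

/-! ### Comparison of central extensions -/

section Comparison

/-- Homomorphisms from a perfect group that agree modulo a central kernel are equal. -/
theorem hom_eq_of_perfect {S C P : Type} [Group S] [Group C] [Group P]
    (hS : commutator S = ⊤) {p : C →* P} (hp : p.ker ≤ Subgroup.center C) {θ θ' : S →* C}
    (h : ∀ x, p (θ x) = p (θ' x)) : θ = θ' := by
  have hc : ∀ x, θ x * (θ' x)⁻¹ ∈ Subgroup.center C := fun x => hp (by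
    rw [MonoidHom.mem_ker, map_mul, map_inv, h, mul_inv_cancel])
  -- The pointwise quotient of `θ` and `θ'` is a homomorphism to an abelian group, hence trivial on
  -- a perfect group.
  let D : S →* Subgroup.center C :=
    { toFun := fun x => ⟨θ x * (θ' x)⁻¹, hc x⟩
      map_one' := Subtype.ext (by simp)
      map_mul' := fun x y => Subtype.ext (by
        change θ (x * y) * (θ' (x * y))⁻¹ = θ x * (θ' x)⁻¹ * (θ y * (θ' y)⁻¹)
        rw [mul_assoc (θ x), Subgroup.mem_center_iff.1 (hc y) (θ' x)⁻¹, map_mul, map_mul]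
        group) }
  refine MonoidHom.ext fun x => ?_
  have hD : commutator S ≤ D.ker := by
    rw [commutator_def, Subgroup.commutator_le]
    intro a _ b _
    rw [MonoidHom.mem_ker, map_commutatorElement, commutatorElement_eq_one_iff_mul_comm]
    exact Subtype.ext (Subgroup.mem_center_iff.1 (D b).2 (D a))
  have h1 : D x = 1 := hD (hS ▸ Subgroup.mem_top x)
  exact mul_inv_eq_one.1 (congrArg Subtype.val h1)

variable {S P : Type} [Group S] [Group P] {ζ : CTwo →* S} {p : S →* P}

/-- Extensions with cohomologous factor sets are isomorphic; here only the homomorphism in one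
direction is needed. -/
theorem IsSchurDoubleCover.exists_lift (h : IsSchurDoubleCover ζ p) {σ : P → S}
    {u : P → P → ZMod 2} (hu : IsFactorSet ζ p σ u) {C : Type} [Group C] {j : CTwo →* C}
    {p' : C →* P} (hj : ∀ a x, x * j a = j a * x) (hjp : ∀ a, p' (j a) = 1) {σ' : P → C}
    {c : P → P → ZMod 2} (hc : IsFactorSet j p' σ' c) {β : P → ZMod 2}
    (hβ : ∀ x y, c x y = β x + β y - β (x * y) + u x y) :
    ∃ θ : S →* C, (∀ x, p' (θ x) = p x) ∧ ∀ a, θ (ζ a) = j a := by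
  have hex : ∀ x : S, ∃ a : ZMod 2, x = ζ (Multiplicative.ofAdd a) * σ (p x) := fun x =>
    h.exists_of_eq (hu.section' _).symm
  choose A hA using hex
  have hchar : ∀ a : ZMod 2, a + a = 0 := by decide
  have hAmul : ∀ x y, A (x * y) = A x + A y + u (p x) (p y) := by
    intro x y
    apply h.ofAdd_mul_cancel (s := σ (p (x * y)))
    rw [← hA, IsSchurDoubleCover.ofAdd_add_mul, IsSchurDoubleCover.ofAdd_add_mul, mul_assoc,
      map_mul, ← hu.mul, mul_assoc, ← mul_assoc _ (σ (p x)), ← h.central _ (σ (p x)), mul_assoc,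
      ← mul_assoc, ← hA, ← hA]
  have hjadd : ∀ a b : ZMod 2, j (Multiplicative.ofAdd (a + b)) =
      j (Multiplicative.ofAdd a) * j (Multiplicative.ofAdd b) := fun a b => map_mul j _ _
  -- Each `x` is a kernel element times `σ (p x)`. The section `σ` is replaced by `σ'`, and `β`
  -- corrects the difference of the factor sets.
  let θ₀ : S → C := fun x => j (Multiplicative.ofAdd (A x + β (p x))) * σ' (p x)
  have hθ : ∀ x y, θ₀ (x * y) = θ₀ x * θ₀ y := by
    intro x y
    change j _ * _ = (j _ * _) * (j _ * _)
    rw [mul_assoc (j _) (σ' (p x)), ← mul_assoc (σ' (p x)), hj, mul_assoc (j _) (σ' (p x)),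
      hc.mul, ← mul_assoc, ← mul_assoc, ← hjadd, ← hjadd, hAmul, map_mul, hβ]
    congr 3
    linear_combination -hchar (β (p x)) - hchar (β (p y)) + hchar (β (p x * p y))
  let θ : S →* C := MonoidHom.mk' θ₀ hθ
  have hθp : ∀ x, p' (θ x) = p x := by
    intro x
    change p' (j _ * _) = _
    rw [map_mul, hjp, one_mul, hc.section']
  refine ⟨θ, hθp, ?_⟩
  -- the restriction to the kernel
  have hk : ∀ a, A (ζ a) = Multiplicative.toAdd a + A 1 := by
    intro a
    apply h.ofAdd_mul_cancel (s := σ (p (ζ a)))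
    rw [← hA, IsSchurDoubleCover.ofAdd_add_mul, mul_assoc, h.apply_ker, ofAdd_toAdd]
    have := hA 1
    rw [map_one] at this
    rw [← this, mul_one]
  intro a
  have h1 : θ 1 = 1 := map_one θ
  change j _ * σ' (p 1) = 1 at h1
  change j _ * σ' (p (ζ a)) = _
  rw [hk, h.apply_ker, add_assoc, hjadd, mul_assoc]
  rw [map_one] at h1
  rw [h1, mul_one, ofAdd_toAdd]

end Comparison

/-! ### Change of coefficients in group cohomology -/

theorem groupCohomology.iCocycles_cocyclesMap {G : Type} [Group G] {A B : Rep.{0} ℤ G}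
    (φ : A ⟶ B) (n : ℕ) (c : groupCohomology.cocycles A n) (g : Fin n → G) :
    groupCohomology.iCocycles B n (groupCohomology.cocyclesMap (MonoidHom.id G) φ n c) g =
      φ.hom (groupCohomology.iCocycles A n c g) := by
  have h := congrArg (fun t => t.hom c) (HomologicalComplex.cyclesMap_i
    (groupCohomology.cochainsMap (A := A) (B := B) (MonoidHom.id G) φ) n)
  exact congrFun h g

/-! ### The obstruction of a homomorphism onto the group of order two -/

open CTwoCohomology

theorem ker_subtype_comp {S G : Type} [Group S] [Group G] {K : Subgroup G} (p : S →* K) :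
    (K.subtype.comp p).ker = p.ker := by
  ext x
  exact ⟨fun hx => Subtype.ext hx, fun hx => congrArg Subtype.val hx⟩

theorem groupCohomology.map_π {G : Type} [Group G] {A B : Rep.{0} ℤ G}
    (φ : A ⟶ B) (n : ℕ) (c : groupCohomology.cocycles A n) :
    groupCohomology.map (MonoidHom.id G) φ n (groupCohomology.π A n c) =
      groupCohomology.π B n (groupCohomology.cocyclesMap (MonoidHom.id G) φ n c) :=
  congrArg (fun t => t.hom c)
    (groupCohomology.π_map (A := A) (B := B) (MonoidHom.id G) φ n)

theorem groupCohomology.map_map_of_comp_eq_id {G : Type} [Group G] {A B : Rep.{0} ℤ G}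
    {φ : A ⟶ B} {ψ : B ⟶ A} (h : φ ≫ ψ = 𝟙 A) (n : ℕ) (o : groupCohomology A n) :
    groupCohomology.map (MonoidHom.id G) ψ n (groupCohomology.map (MonoidHom.id G) φ n o) = o := by
  have e := groupCohomology.map_id_comp φ ψ n
  rw [h] at e
  have e' : groupCohomology.map (MonoidHom.id G) (𝟙 A) n = 𝟙 (groupCohomology A n) :=
    groupCohomology.map_id n
  exact (congrArg (fun t => t.hom o) e).symm.trans (congrArg (fun t => t.hom o) e')

/-- A crossed module `S → G` over `f : G → ℤ/2` that is a double cover of the kernel of `f` as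
in `IsSchurDoubleCover`, in which an element of `G` outside the kernel maps a lift of its square
to the negative of the lift. -/
structure IsSchurCrossedModule {S G : Type} [Group S] [Group G] (f : G →* CTwo) (ζ : CTwo →* S)
    (pr : S →* f.ker) (act : G →* MulAut S) : Prop extends IsSchurDoubleCover ζ pr where
  onto : Function.Surjective f
  crossed : IsCrossedModule (f.ker.subtype.comp pr) act
  act_ker : ∀ g a, act g (ζ a) = ζ a
  act_sq : ∀ g Φ, f g = gen → g * g = pr Φ → act g Φ = ζ gen * Φ

namespace IsSchurCrossedModule

variable {S G : Type} [Group S] [Group G] {f : G →* CTwo} {ζ : CTwo →* S} {pr : S →* f.ker}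
  {act : G →* MulAut S} (h : IsSchurCrossedModule f ζ pr act)

include h

/-- A factor set of the double cover. -/
def factor : f.ker → f.ker → ZMod 2 := h.exists_factorSet.choose_spec.choose

/-- The section with the chosen factor set. -/
def sec : f.ker → S := h.exists_factorSet.choose

theorem isFactorSet : IsFactorSet ζ pr h.sec h.factor :=
  h.exists_factorSet.choose_spec.choose_spec

/-- The isomorphism of `H₂(ker f, ℤ/2)` with `ℤ/2`. -/
def equiv : HTwo f.ker (ZMod 2) ≃ₗ[ℤ] ZMod 2 :=
  LinearEquiv.ofBijective _ (h.evalHTwo_bijective h.isFactorSet)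

/-- A group of order two has no non-trivial automorphism, so every action on `H₂(ker f, ℤ/2)` is
trivial. -/
theorem equiv_kerRep (g : CTwo) (x : HTwo f.ker (ZMod 2)) :
    h.equiv (kerRep f h.onto (ZMod 2) g x) = h.equiv x := by
  have h2 : ∀ a b : ZMod 2, a ≠ 0 → b ≠ 0 → a = b := by decide
  by_cases hx : x = 0
  · rw [hx, map_zero]
  · refine h2 _ _ ?_ ?_
    · rw [Ne, LinearEquiv.map_eq_zero_iff]
      intro h0
      apply hx
      have h1 := congrArg (kerRep f h.onto (ZMod 2) g⁻¹) h0
      rw [← Module.End.mul_apply, ← map_mul, inv_mul_cancel, map_one, map_zero] at h1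
      exact h1
    · rwa [Ne, LinearEquiv.map_eq_zero_iff]

theorem kerRep_apply_self (g : CTwo) (x : HTwo f.ker (ZMod 2)) :
    kerRep f h.onto (ZMod 2) g x = x :=
  h.equiv.injective (h.equiv_kerRep g x)

theorem conjRep_apply_self (g : G) (x : HTwo f.ker (ZMod 2)) :
    conjRep f.ker (ZMod 2) g x = x := by
  rw [← kerRep_apply f h.onto, h.kerRep_apply_self]

/-- The isomorphism of `H₂(ker f, ℤ/2)` with the trivial module `ℤ/2`. -/
def repIso : Rep.of (kerRep f h.onto (ZMod 2)) ≅ Rep.trivial ℤ CTwo (ZMod 2) where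
  hom := Rep.ofHom ⟨h.equiv.toLinearMap, fun g => LinearMap.ext (h.equiv_kerRep g)⟩
  inv := Rep.ofHom ⟨h.equiv.symm.toLinearMap, fun g => LinearMap.ext fun x =>
    (h.kerRep_apply_self g (h.equiv.symm x)).symm⟩
  hom_inv_id := Rep.hom_ext (by ext x; exact h.equiv.symm_apply_apply x)
  inv_hom_id := Rep.hom_ext (by ext x; exact h.equiv.apply_symm_apply x)

/-- The identification of the kernel of the double cover with `H₂(ker f, ℤ/2)`. -/
abbrev kerHom : Multiplicative (HTwo f.ker (ZMod 2)) →* S :=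
  ζ.comp (AddMonoidHom.toMultiplicative h.repIso.hom.hom.toLinearMap.toAddMonoidHom)

theorem kerHom_ofAdd (x : HTwo f.ker (ZMod 2)) :
    h.kerHom (Multiplicative.ofAdd x) = ζ (Multiplicative.ofAdd (h.equiv x)) := rfl

theorem range_kerHom : h.kerHom.range = pr.ker := by
  rw [← h.exact]
  ext y
  constructor
  · rintro ⟨x, rfl⟩
    exact ⟨_, rfl⟩
  · rintro ⟨a, rfl⟩
    refine ⟨Multiplicative.ofAdd (h.equiv.symm (Multiplicative.toAdd a)), ?_⟩
    rw [h.kerHom_ofAdd, LinearEquiv.apply_symm_apply, ofAdd_toAdd]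

theorem kerHom_injective : Function.Injective h.kerHom := fun x y hxy => by
  have h1 : ζ (Multiplicative.ofAdd (h.equiv (Multiplicative.toAdd x))) =
    ζ (Multiplicative.ofAdd (h.equiv (Multiplicative.toAdd y))) := hxy
  exact Multiplicative.toAdd.injective
    (h.equiv.injective (Multiplicative.ofAdd.injective (h.injective h1)))

theorem pr_act (g : G) (x : S) : pr (act g x) = MulAut.conjNormal g (pr x) :=
  Subtype.ext (h.crossed.map_act g x)

/-- The identification of the kernel is defined by evaluating the factor set, so the classifying map
of the cover is reduction modulo two by construction. -/
theorem isObstructionCrossedModule :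
    IsObstructionCrossedModule f (1 : ZMod 2) h.kerHom pr act where
  extension :=
    { injective := h.kerHom_injective
      surjective := h.surjective
      exact := h.range_kerHom
      central := by
        rintro _ ⟨x, rfl⟩
        exact Subgroup.mem_center_iff.2 fun y => h.central _ y
      classified := by
        refine ⟨h.sec, fun xy => h.equiv.symm (h.factor xy.1 xy.2), h.isFactorSet.section', ?_, ?_⟩
        · intro x y
          rw [h.kerHom_ofAdd, LinearEquiv.apply_symm_apply, h.isFactorSet.mul]
        · intro z
          apply h.equiv.injective
          refine (evalHTwo_map (h.isTwoCocycle h.isFactorSet) z).trans ?_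
          rw [map_finsuppSum]
          refine Finsupp.sum_congr fun xy _ => ?_
          rw [map_zsmul, LinearEquiv.apply_symm_apply] }
  crossed := h.crossed
  act_proj := h.pr_act
  act_kernel g n := by
    rw [h.kerHom_ofAdd, h.act_ker, h.conjRep_apply_self, h.kerHom_ofAdd]

/-- With a normalized section and lift, the only non-trivial value is `F gen gen = Φ`, a lift of the
square of `m = s gen`. The only relation with a sign is the one at `(gen, gen, gen)`, where it comes
from `act_sq`; so the cocycle is the cup cube on the nose. -/
theorem exists_cocycle : ∃ (s : CTwo → G) (F : CTwo → CTwo → S),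
    (∀ x, f (s x) = x) ∧ (∀ x y, s x * s y = pr (F x y) * s (x * y)) ∧
    ∀ x y w, act (s x) (F y w) * F x (y * w) = ζ (Multiplicative.ofAdd
      (Multiplicative.toAdd x * Multiplicative.toAdd y * Multiplicative.toAdd w)) *
        F x y * F (x * y) w := by
  obtain ⟨m, hm⟩ := h.onto gen
  obtain ⟨Φ, hΦ⟩ := h.surjective ⟨m * m, by rw [MonoidHom.mem_ker, map_mul, hm]; rfl⟩
  have hΦ' : m * m = pr Φ := by rw [hΦ]
  have hsq := h.act_sq m Φ hm hΦ'
  have hg : gen ≠ 1 := by decide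
  obtain ⟨s, hs1, hsg⟩ : ∃ s : CTwo → G, s 1 = 1 ∧ s gen = m :=
    ⟨fun x => if x = 1 then 1 else m, if_pos rfl, if_neg hg⟩
  obtain ⟨F, h11, h1g, hg1, hgg⟩ : ∃ F : CTwo → CTwo → S,
      F 1 1 = 1 ∧ F 1 gen = 1 ∧ F gen 1 = 1 ∧ F gen gen = Φ :=
    ⟨fun x y => if x = 1 then 1 else if y = 1 then 1 else Φ, by simp, by simp, by simp,
      by simp [hg]⟩
  have hgg' : gen * gen = 1 := rfl
  have hz : ζ (Multiplicative.ofAdd 0) = 1 := map_one ζ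
  refine ⟨s, F, fun x => ?_, fun x y => ?_, fun x y w => ?_⟩
  · rcases CTwo.eq_one_or x with rfl | rfl
    · rw [hs1, map_one]
    · rw [hsg, hm]
  · rcases CTwo.eq_one_or x with rfl | rfl <;> rcases CTwo.eq_one_or y with rfl | rfl <;>
      simp only [hs1, hsg, h11, h1g, hg1, hgg, hgg', mul_one, one_mul, map_one,
        Subgroup.coe_one, hΦ']
  · rcases CTwo.eq_one_or x with rfl | rfl <;> rcases CTwo.eq_one_or y with rfl | rfl <;>
      rcases CTwo.eq_one_or w with rfl | rfl <;>
      simp only [hs1, hsg, h11, h1g, hg1, hgg, hgg', mul_one, one_mul, map_one, toAdd_one,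
        toAdd_ofAdd, mul_zero, hz, hsq, MulAut.one_apply]

theorem isClassOf_trivial : IsClassOf (Rep.trivial ℤ CTwo (ZMod 2)) ζ (f.ker.subtype.comp pr)
    act f (groupCohomology.π Triv 3 cubeCocycle) := by
  obtain ⟨s, F, hs, hsF, hF⟩ := h.exists_cocycle
  refine ⟨{ h.crossed with
    injective := h.injective
    exact_left := ?_
    exact_right := ?_
    surjective := h.onto
    act_kernel := fun g n => h.act_ker g _ }, s, F, cubeCocycle, hs, hsF, fun x y w => ?_, rfl⟩
  · rw [h.exact, ker_subtype_comp]
  · rw [MonoidHom.range_comp, MonoidHom.range_eq_top.2 h.surjective, ← MonoidHom.range_eq_map,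
      Subgroup.range_subtype]
  · rw [hF, iCocycles_cubeCocycle]
    rfl

theorem isClassOf_kerRep : IsClassOf (Rep.of (kerRep f h.onto (ZMod 2))) h.kerHom
    (f.ker.subtype.comp pr) act f
    (groupCohomology.map (MonoidHom.id CTwo) h.repIso.inv 3
      (groupCohomology.π Triv 3 cubeCocycle)) := by
  obtain ⟨s, F, hs, hsF, hF⟩ := h.exists_cocycle
  refine ⟨{ h.crossed with
    injective := h.kerHom_injective
    exact_left := ?_
    exact_right := ?_
    surjective := h.onto
    act_kernel := fun g n => ?_ }, s, F,
    groupCohomology.cocyclesMap (MonoidHom.id CTwo) h.repIso.inv 3 cubeCocycle, hs, hsF,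
    fun x y w => ?_, ?_⟩
  · rw [h.range_kerHom, ker_subtype_comp]
  · rw [MonoidHom.range_comp, MonoidHom.range_eq_top.2 h.surjective, ← MonoidHom.range_eq_map,
      Subgroup.range_subtype]
  · refine (h.act_ker g _).trans ?_
    exact congrArg (fun a => h.kerHom (Multiplicative.ofAdd a)) (h.kerRep_apply_self (f g) n).symm
  · rw [hF, groupCohomology.iCocycles_cocyclesMap, iCocycles_cubeCocycle]
    congr 2
    refine Eq.trans ?_ (h.kerHom_ofAdd _).symm
    exact congrArg (fun a => ζ (Multiplicative.ofAdd a)) (h.equiv.apply_symm_apply _).symm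
  · exact (groupCohomology.map_π h.repIso.inv 3 cubeCocycle).symm

theorem map_map_inv (o : groupCohomology (Rep.of (kerRep f h.onto (ZMod 2))) 3) :
    groupCohomology.map (MonoidHom.id CTwo) h.repIso.inv 3
      (groupCohomology.map (MonoidHom.id CTwo) h.repIso.hom 3 o) = o :=
  groupCohomology.map_map_of_comp_eq_id h.repIso.hom_inv_id 3 o

theorem map_inv_map (o : groupCohomology Triv 3) :
    groupCohomology.map (MonoidHom.id CTwo) h.repIso.hom 3
      (groupCohomology.map (MonoidHom.id CTwo) h.repIso.inv 3 o) = o :=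
  groupCohomology.map_map_of_comp_eq_id h.repIso.inv_hom_id 3 o

/-- All obstruction crossed modules have the same class. -/
theorem map_obstruction {C : Type} [Group C] {ι : Multiplicative (HTwo f.ker (ZMod 2)) →* C}
    {p : C →* f.ker} {act' : G →* MulAut C}
    (hC : IsObstructionCrossedModule f (1 : ZMod 2) ι p act')
    {o : groupCohomology (Rep.of (kerRep f h.onto (ZMod 2))) 3}
    (ho : IsClassOf (Rep.of (kerRep f h.onto (ZMod 2))) ι (f.ker.subtype.comp p) act' f o) :
    groupCohomology.map (MonoidHom.id CTwo) h.repIso.hom 3 o =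
      groupCohomology.π Triv 3 cubeCocycle := by
  let j : CTwo →* C := ι.comp (AddMonoidHom.toMultiplicative
    (h.equiv.symm : ZMod 2 →ₗ[ℤ] HTwo f.ker (ZMod 2)).toAddMonoidHom)
  have hj_ofAdd : ∀ n, ι (Multiplicative.ofAdd n) = j (Multiplicative.ofAdd (h.equiv n)) :=
    fun n => congrArg (fun t => ι (Multiplicative.ofAdd t)) (h.equiv.symm_apply_apply n).symm
  have hjinj : Function.Injective j := fun a b hab =>
    Multiplicative.toAdd.injective (h.equiv.symm.injective
      (Multiplicative.ofAdd.injective (hC.extension.injective hab)))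
  have hjcen : ∀ a x, x * j a = j a * x := fun a x =>
    Subgroup.mem_center_iff.1 (hC.extension.central ⟨_, rfl⟩) x
  have hjp : ∀ a, p (j a) = 1 := fun a => by
    have : j a ∈ p.ker := hC.extension.exact ▸ ⟨_, rfl⟩
    exact this
  have hker : ∀ x, p x = 1 → ∃ a, x = j a := fun x hx => by
    have : x ∈ ι.range := by rw [hC.extension.exact]; exact hx
    obtain ⟨n, rfl⟩ := this
    exact ⟨_, hj_ofAdd _⟩
  have hkc : p.ker ≤ Subgroup.center C := hC.extension.exact ▸ hC.extension.central
  have hjact : ∀ g a, act' g (j a) = j a := fun g a => by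
    refine (hC.act_kernel g _).trans ?_
    exact congrArg (fun t => ι (Multiplicative.ofAdd t)) (h.conjRep_apply_self g _)
  obtain ⟨σ', u', hσ', hu', hz⟩ := hC.extension.classified
  let c : f.ker → f.ker → ZMod 2 := fun x y => h.equiv (u' (x, y))
  have hcF : IsFactorSet j p σ' c := ⟨hσ', fun x y => by rw [hu', hj_ofAdd]⟩
  have hjadd : ∀ a b : ZMod 2, j (Multiplicative.ofAdd (a + b)) =
      j (Multiplicative.ofAdd a) * j (Multiplicative.ofAdd b) := fun a b => map_mul j _ _
  have hcc : IsTwoCocycle c := fun x y w => by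
    have e := mul_assoc (σ' x) (σ' y) (σ' w)
    rw [hcF.mul x y, hcF.mul y w, mul_assoc, hcF.mul (x * y) w, ← mul_assoc (σ' x), hjcen,
      mul_assoc _ (σ' x), hcF.mul x (y * w), ← mul_assoc, ← mul_assoc, mul_assoc x,
      ← hjadd, ← hjadd] at e
    exact Multiplicative.ofAdd.injective (hjinj (mul_right_cancel e))
  -- Both extensions are classified by reduction modulo two, so their factor sets agree on integral
  -- cycles.
  obtain ⟨β, hβ⟩ := h.exists_sub_factorSet h.isFactorSet hcc fun z => by
    have e := congrArg h.equiv (hz z)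
    refine Eq.trans ?_ (e.symm.trans (evalHTwo_map (h.isTwoCocycle h.isFactorSet) z))
    rw [map_finsuppSum]
    exact Finsupp.sum_congr fun xy _ => (map_zsmul h.equiv _ _).symm
  obtain ⟨θ, hθp, hθζ⟩ := h.exists_lift h.isFactorSet hjcen hjp hcF hβ
  -- Both composites lift the same map to `f.ker`, and `C` is central over it, so perfectness of `S`
  -- forces equality.
  have hequi : ∀ g x, act' g (θ x) = θ (act g x) := by
    intro g x
    refine DFunLike.congr_fun (hom_eq_of_perfect (θ := (act' g).toMonoidHom.comp θ)
      (θ' := θ.comp (act g).toMonoidHom) h.perfect hkc fun x => ?_) x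
    change p (act' g (θ x)) = p (θ (act g x))
    rw [hC.act_proj, hθp, hθp, h.pr_act]
  obtain ⟨hext, s, F, c₃, hs, hsF, hF, rfl⟩ := ho
  refine (groupCohomology.map_π h.repIso.hom 3 c₃).trans (π_eq_of_invariant ?_)
  rw [invariant_cubeCocycle]
  have hinv := invariant_of_crossed (d := f.ker.subtype.comp p) (act := act') hC.crossed hjinj
    hjcen (c := fun v => h.equiv (groupCohomology.iCocycles _ 3 c₃ v)) hsF
    (fun x y w => by rw [hF, hj_ofAdd]) fun Φ hΦ => by
      -- A lift of the square in `C` is the image of one in `S` times a central element fixed by the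
      -- action, so the sign passes from `S` to `C`.
      obtain ⟨y, hy⟩ := h.surjective (p Φ)
      obtain ⟨a, ha⟩ := hker (Φ * (θ y)⁻¹) (by
        rw [map_mul, map_inv, hθp, hy, mul_inv_cancel])
      have hΦy : Φ = j a * θ y := by rw [← ha, inv_mul_cancel_right]
      have hsq := h.act_sq (s gen) y (hs gen) (by rw [hy]; exact hΦ)
      rw [hΦy, map_mul, hjact, hequi, hsq, map_mul, hθζ, ← mul_assoc, ← mul_assoc, hjcen]
  refine Eq.trans ?_ hinv
  refine congrArg invariant (funext fun v => ?_)
  exact groupCohomology.iCocycles_cocyclesMap h.repIso.hom 3 c₃ v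

/-- Existence is witnessed by `S` itself. Uniqueness is `map_obstruction`, since the change of
coefficients is invertible. -/
theorem isObstruction : IsObstruction f h.onto (1 : ZMod 2)
    (groupCohomology.map (MonoidHom.id CTwo) h.repIso.inv 3
      (groupCohomology.π Triv 3 cubeCocycle)) := by
  refine Set.eq_singleton_iff_unique_mem.2 ⟨?_, ?_⟩
  · exact ⟨S, inferInstance, h.kerHom, pr, act, h.isObstructionCrossedModule, h.isClassOf_kerRep⟩
  · rintro o ⟨C, hC, ι, p, act', hobs, hcl⟩
    rw [← h.map_obstruction hobs hcl, h.map_map_inv]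

theorem obstruction_ne_zero : groupCohomology.map (MonoidHom.id CTwo) h.repIso.inv 3
    (groupCohomology.π Triv 3 cubeCocycle) ≠ 0 := fun h0 => by
  have e := h.map_inv_map (groupCohomology.π Triv 3 cubeCocycle)
  rw [h0, map_zero] at e
  exact π_ne_zero_of_invariant invariant_cubeCocycle e.symm

/-- A quotient of a perfect group is perfect, so the abelianization has order one. -/
theorem odd_card_abelianization : Odd (Nat.card (Abelianization f.ker)) := by
  have : Group.IsPerfect S := ⟨h.perfect⟩
  have : Group.IsPerfect f.ker := Group.IsPerfect.ofSurjective h.surjective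
  have : Subsingleton (Abelianization f.ker) := ⟨fun a b => by
    induction a using QuotientGroup.induction_on with | H x =>
    induction b using QuotientGroup.induction_on with | H y =>
    exact QuotientGroup.eq.2 (Group.IsPerfect.commutator_eq_top (G := f.ker) ▸ Subgroup.mem_top _)⟩
  rw [Nat.card_of_subsingleton 1]
  exact odd_one

end IsSchurCrossedModule

/-! ### The crossed module of `M(q²)` and the Frobenius automorphism -/

theorem isSchurCrossedModule_slProj {F : Type} [Field F] [Fintype F] {α : RingAut F} {q : ℕ}
    (hodd : Odd q) (hF : Fintype.card F = q ^ 2) (hαq : ∀ x : F, α x = x ^ q)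
    (hQ : Fintype.card F % 4 = 1) (hα : α * α = 1) (hα1 : α ≠ 1) :
    IsSchurCrossedModule (mSign hα) (signSL F) (slProj hα)
      ((semiAct α).comp (MGroup α).subtype) where
  toIsSchurDoubleCover := isSchurDoubleCover_slProj hQ hα hα1
  onto := mSign_surjective hQ hα hα1
  crossed := isCrossedModule_slProj hα
  act_ker g a := semiAct_signSL g.1 a
  act_sq g Φ hg hΦ := by
    have h1 : semiChar hα g.1 = 1 := by
      have h0 : MGroup α ≤ (semiChar hα).ker := (MGroup_eq_ker hα hα1).le
      exact h0 g.2
    have hs : semiSign hα g.1 ≠ 1 := by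
      rw [show semiSign hα g.1 = mSign hα g from rfl, hg]
      decide
    refine (semiAct_eq_neg hodd hF hαq hα h1 hs (congrArg Subtype.val hΦ)).trans ?_
    rw [signSL_ofAdd_one, neg_one_mul]

theorem card_mod_four {q Q : ℕ} (hodd : Odd q) (hQ : Q = q ^ 2) : Q % 4 = 1 := by
  obtain ⟨k, rfl⟩ := hodd
  rw [hQ, show (2 * k + 1) ^ 2 = 4 * (k * k + k) + 1 by ring]
  omega

theorem frobenius_mul_self {F : Type} [Field F] [Fintype F] {α : RingAut F} {q : ℕ}
    (hF : Fintype.card F = q ^ 2) (hαq : ∀ x : F, α x = x ^ q) : α * α = 1 :=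
  RingEquiv.ext fun x => by
    change α (α x) = x
    rw [hαq, hαq, ← pow_mul, ← pow_two, ← hF, FiniteField.pow_card]

/-- If `α` were trivial, every non-zero `a` would satisfy `a^(q-1) = 1`. As `q - 1` divides `(q² -
1)/2`, Euler's criterion would make every element a square. -/
theorem frobenius_ne_one {F : Type} [Field F] [Fintype F] {α : RingAut F} {q : ℕ}
    (hodd : Odd q) (hF : Fintype.card F = q ^ 2) (hαq : ∀ x : F, α x = x ^ q) : α ≠ 1 := by
  rintro rfl
  have h2 : ringChar F ≠ 2 := fun h => by
    have := FiniteField.even_card_of_char_two h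
    have := card_mod_four hodd hF
    omega
  obtain ⟨a, ha⟩ := FiniteField.exists_nonsquare h2
  have ha0 : a ≠ 0 := fun h => ha (h ▸ IsSquare.zero)
  obtain ⟨k, rfl⟩ := hodd
  apply ha
  have h1 : a = a ^ (2 * k + 1) := hαq a
  have hk : Fintype.card F / 2 = 2 * k * (k + 1) := by
    rw [hF, show (2 * k + 1) ^ 2 = 2 * (2 * k * (k + 1)) + 1 by ring]
    omega
  have h3 : a ^ (2 * k) = 1 := mul_right_cancel₀ ha0 (by rw [← pow_succ, ← h1, one_mul])
  rw [FiniteField.isSquare_iff h2 ha0, hk, pow_mul, h3, one_pow]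

end

theorem mainTheorem10 (q : ℕ) (hq : IsPrimePow q) (hodd : Odd q)
    (F : Type) [Field F] [Fintype F] (hF : Fintype.card F = q ^ 2)
    (α : RingAut F) (hα : ∀ x : F, α x = x ^ q) :
    (∀ τ : PGL(2, F), τ ∉ (Matrix.ProjectiveSpecialLinearGroup.toPGL (n := Fin 2) (R := F)).range →
      (MGroup α : Set (PGLSemi α)) =
        (pslSub α : Set (PGLSemi α)) ∪ {y | ∃ x ∈ pslSub α, y = galElt α * SemidirectProduct.inl τ * x}) ∧
    (MGroup α).index = 2 ∧
    PropertyStarA (MGroup α) ∧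
    ∃ (f : MGroup α →* CTwo) (hf : Function.Surjective f)
      (o : groupCohomology (Rep.of (kerRep f hf (ZMod 2))) 3)
      (e : Rep.of (kerRep f hf (ZMod 2)) ≅ Rep.trivial ℤ CTwo (ZMod 2))
      (pr : SL(2, F) →* f.ker),
      f.ker = (pslSub α).subgroupOf (MGroup α) ∧
      (∀ y : SL(2, F), ((pr y : MGroup α) : PGLSemi α) =
        SemidirectProduct.inl (Matrix.SpecialLinearGroup.toPGL y)) ∧
      IsObstruction f hf (1 : ZMod 2) o ∧
      IsObstructionCrossedModule f (1 : ZMod 2)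
        ((signSL F).comp (AddMonoidHom.toMultiplicative e.hom.hom.toLinearMap.toAddMonoidHom))
        pr ((semiAct α).comp (MGroup α).subtype) ∧
      IsClassOf (Rep.trivial ℤ CTwo (ZMod 2)) (signSL F) (f.ker.subtype.comp pr)
        ((semiAct α).comp (MGroup α).subtype) f
        (groupCohomology.map (MonoidHom.id CTwo) e.hom 3 o) ∧
      ∃ u : HTriv CTwo (ZMod 2) 1, u ≠ 0 ∧ (∀ v : HTriv CTwo (ZMod 2) 1, v ≠ 0 → v = u) ∧
        IsCube u (groupCohomology.map (MonoidHom.id CTwo) e.hom 3 o) := by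
  have hQ := card_mod_four hodd hF
  have hα2 := frobenius_mul_self hF hα
  have hα1 := frobenius_ne_one hodd hF hα
  have h := isSchurCrossedModule_slProj hodd hF hα hQ hα2 hα1
  refine ⟨fun τ hτ => coe_MGroup hα2 hα1 hτ, index_MGroup hα2 hα1,
    ⟨inferInstance, mSign hα2, h.onto, h.odd_card_abelianization, _, h.isObstruction,
      h.obstruction_ne_zero⟩,
    mSign hα2, h.onto, _, h.repIso, slProj hα2, ker_mSign hα2 hα1, fun y => rfl, h.isObstruction,
    h.isObstructionCrossedModule, ?_,
    groupCohomology.π CTwoCohomology.Triv 1 CTwoCohomology.oneCocycle,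
    CTwoCohomology.π_oneCocycle_ne_zero,
    fun v hv => CTwoCohomology.eq_π_oneCocycle hv, ?_⟩
  · rw [h.map_inv_map]
    exact h.isClassOf_trivial
  · rw [h.map_inv_map]
    exact CTwoCohomology.isCube
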